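/- Let $M$ be an oriented smooth Riemannian surface (a two-dimensional manifold without boundary) with Gaussian curvature $K$, and let $J$ denote counterclockwise rotation by $\pi/2$ in its tangent planes. Let $m>0$ and $I_a>0$ be constants and let $a<b$. For a smooth curve $(\gamma,u)$ in the unit tangent bundle of $M$, defined on $[a,b]$ (that is, $\gamma$ is a smooth curve in $M$ and $u$ is a smooth field of unit tangent vectors along $\gamma$), consider the action $$\mathcal S(\gamma,u)=\int_a^b\Big(\tfrac12 m|\dot\gamma|^2+\tfrac12 I_a|D_tu|^2\Big)\,dt ,$$ where $D_t$ is the covariant derivative along $\gamma$; its integrand is the kinetic energy of a small, rapidly spinning disk of mass $m$ and axial moment of inertia $I_a$ with center $\gamma$, on which the direction $u$ is marked. Suppose that $(\gamma,u)$ is a critical curve of $\mathcal S$, that is, $\frac{d}{ds}\big|_{s=0}\mathcal S(\gamma_s,u_s)=0$ for every smooth family $(\gamma_s,u_s)$, $|s|<\varepsilon$, of curves in the unit tangent bundle with $(\gamma_0,u_0)=(\gamma,u)$ and with the same endpoints as $(\gamma,u)$. Then the angular momentum $L=I_a\,\omega_a$, where $\omega_a=\langle D_tu,Ju\rangle$ is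 the axial angular velocity, is constant on $[a,b]$, and the center of the disk moves according to $$m\,D_t\dot\gamma=L\,K(\gamma)\,J\dot\gamma \qquad\text{on } [a,b].$$ -/

import Mathlib

open scoped Manifold ContDiff Bundle RealInnerProductSpace
open Bundle

noncomputable section

namespace SpinningDisk

/-- The model plane. A surface `M` is a smooth manifold modelled on it (without boundary), and a
Riemannian metric on `M` is a smooth inner product on its tangent bundle. -/
abbrev Plane : Type := EuclideanSpace ℝ (Fin 2)

section Surface

variable {M : Type*} [TopologicalSpace M] [ChartedSpace Plane M] [IsManifold (𝓡 2) ∞ M]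

/-- The coordinate vector `∂ᵢ` at the point `x`, for the chart around `p`
(meaningful for `x` in the domain of that chart). -/
def coordVec (p x : M) (i : Fin 2) : TangentSpace (𝓡 2) x :=
  (trivializationAt Plane (TangentSpace (𝓡 2) : M → Type _) p).symmL ℝ x
    (EuclideanSpace.single i 1)

/-- The components `Xⁱ` of a tangent vector `X = ∑ Xⁱ ∂ᵢ` at `x`, for the chart around `p`. -/
def comp (p x : M) (X : TangentSpace (𝓡 2) x) (i : Fin 2) : ℝ :=
  ((trivializationAt Plane (TangentSpace (𝓡 2) : M → Type _) p).continuousLinearMapAt ℝ x X :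
    Plane) i

/-- The partial derivative `∂ᵢ f` of a function of the two coordinates. -/
def pderiv (i : Fin 2) (f : Plane → ℝ) (y : Plane) : ℝ :=
  fderiv ℝ f y (EuclideanSpace.single i 1)

/-- The velocity `γ'(t)` of a curve `γ` that is defined on the time interval `T`
(one-sided at an endpoint of `T`). -/
def velocity (T : Set ℝ) (γ : ℝ → M) (t : ℝ) : TangentSpace (𝓡 2) (γ t) :=
  mfderivWithin 𝓘(ℝ, ℝ) (𝓡 2) γ T t (1 : ℝ)

/-- The base curve `γ` of a curve `c = (γ, u)` in the tangent bundle. -/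
def baseCurve (c : ℝ → TangentBundle (𝓡 2) M) (t : ℝ) : M := (c t).proj

/-- The vector field `u` along `γ` of a curve `c = (γ, u)` in the tangent bundle. -/
def pointer (c : ℝ → TangentBundle (𝓡 2) M) (t : ℝ) : TangentSpace (𝓡 2) (baseCurve c t) :=
  (c t).snd

instance factFinrank (x : M) : Fact (Module.finrank ℝ (TangentSpace (𝓡 2) x) = 2) :=
  ⟨finrank_euclideanSpace_fin (𝕜 := ℝ) (n := 2)⟩

variable [RiemannianBundle (fun x : M => TangentSpace (𝓡 2) x)]

/-- The matrix `gᵢⱼ = ⟨∂ᵢ, ∂ⱼ⟩` of the metric in the chart around `p`, as a function of the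
coordinates. -/
def metricCoeff (p : M) (y : Plane) : Matrix (Fin 2) (Fin 2) ℝ :=
  Matrix.of fun i j =>
    ⟪coordVec p ((extChartAt (𝓡 2) p).symm y) i, coordVec p ((extChartAt (𝓡 2) p).symm y) j⟫

/-- The Christoffel symbols `Γᵏᵢⱼ = ½ ∑ₗ gᵏˡ (∂ᵢ gⱼₗ + ∂ⱼ gᵢₗ - ∂ₗ gᵢⱼ)` of the Levi-Civita
connection in the chart around `p`. -/
def christoffel (p : M) (k i j : Fin 2) (y : Plane) : ℝ :=
  (1 / 2) * ∑ l, (metricCoeff p y)⁻¹ k l *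
    (pderiv i (fun z => metricCoeff p z j l) y + pderiv j (fun z => metricCoeff p z i l) y
      - pderiv l (fun z => metricCoeff p z i j) y)

/-- The component `Rˡ` of `R(∂ᵢ, ∂ⱼ)∂ₖ = ∇ᵢ∇ⱼ∂ₖ - ∇ⱼ∇ᵢ∂ₖ = ∑ₗ Rˡ ∂ₗ` in the chart around `p`. -/
def riemannCoeff (p : M) (l k i j : Fin 2) (y : Plane) : ℝ :=
  pderiv i (christoffel p l j k) y - pderiv j (christoffel p l i k) y
    + ∑ n, (christoffel p n j k y * christoffel p l i n y
      - christoffel p n i k y * christoffel p l j n y)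

/-- The Gaussian curvature `K = ⟨R(∂₁, ∂₂)∂₂, ∂₁⟩ / (g₁₁ g₂₂ - g₁₂²)` at `x`, computed in the
chart around `x`. -/
def gaussianCurvature (x : M) : ℝ :=
  (∑ l, riemannCoeff x l 1 0 1 (extChartAt (𝓡 2) x x) *
      metricCoeff x (extChartAt (𝓡 2) x x) l 0) /
    (metricCoeff x (extChartAt (𝓡 2) x x)).det

/-- The covariant derivative `D_t X = ∑ₖ (dXᵏ/dt + ∑ᵢⱼ Γᵏᵢⱼ (dγⁱ/dt) Xʲ) ∂ₖ` of a vector field `X`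
along a curve `γ` defined on the time interval `T`; its value at time `t` is computed in the chart
around `γ t`. -/
def covDeriv (T : Set ℝ) (γ : ℝ → M) (X : ∀ t, TangentSpace (𝓡 2) (γ t)) (t : ℝ) :
    TangentSpace (𝓡 2) (γ t) :=
  ∑ k, (derivWithin (fun τ => comp (γ t) (γ τ) (X τ) k) T t
      + ∑ i, ∑ j, christoffel (γ t) k i j (extChartAt (𝓡 2) (γ t) (γ t)) *
          comp (γ t) (γ t) (velocity T γ t) i * comp (γ t) (γ t) (X t) j) •
    coordVec (γ t) (γ t) k

/-- A choice of orientation of every tangent plane is an orientation of the surface if it varies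
continuously: in every chart, the oriented area of the parallelogram spanned by the coordinate
vectors `∂₁, ∂₂` is continuous. -/
def IsOrientationField (o : ∀ x : M, Orientation ℝ (TangentSpace (𝓡 2) x) (Fin 2)) : Prop :=
  ∀ p : M, ContinuousOn (fun x => (o x).areaForm (coordVec p x 0) (coordVec p x 1))
    (chartAt Plane p).source

/-- A smooth curve, defined on `[a, b]`, in the unit tangent bundle. -/
def IsUnitCurve (a b : ℝ) (c : ℝ → TangentBundle (𝓡 2) M) : Prop :=
  ContMDiffOn 𝓘(ℝ, ℝ) (𝓡 2).tangent ∞ c (Set.Icc a b) ∧ ∀ t ∈ Set.Icc a b, ‖pointer c t‖ = 1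

/-- A smooth family `C s`, `-ε < s < ε`, of curves in the unit tangent bundle defined on `[a, b]`,
with `C 0 = c` and with the same endpoints as `c`. -/
structure IsVariation (a b : ℝ) (c : ℝ → TangentBundle (𝓡 2) M) (ε : ℝ)
    (C : ℝ → ℝ → TangentBundle (𝓡 2) M) : Prop where
  pos : 0 < ε
  smooth : ContMDiffOn 𝓘(ℝ, ℝ × ℝ) (𝓡 2).tangent ∞ (fun q : ℝ × ℝ => C q.1 q.2)
    (Set.Ioo (-ε) ε ×ˢ Set.Icc a b)
  unit : ∀ s ∈ Set.Ioo (-ε) ε, ∀ t ∈ Set.Icc a b, ‖pointer (C s) t‖ = 1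
  zero : ∀ t ∈ Set.Icc a b, C 0 t = c t
  left : ∀ s ∈ Set.Ioo (-ε) ε, C s a = c a
  right : ∀ s ∈ Set.Ioo (-ε) ε, C s b = c b

/-- The kinetic energy `½ m |γ'|² + ½ Iₐ |D_t u|²` at time `t` of the motion `(γ, u)` on `T`. -/
def energy (m Ia : ℝ) (T : Set ℝ) (c : ℝ → TangentBundle (𝓡 2) M) (t : ℝ) : ℝ :=
  1 / 2 * m * ‖velocity T (baseCurve c) t‖ ^ 2
    + 1 / 2 * Ia * ‖covDeriv T (baseCurve c) (pointer c) t‖ ^ 2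

/-- The action of the motion `(γ, u)` on `[a, b]`. -/
def action (m Ia a b : ℝ) (c : ℝ → TangentBundle (𝓡 2) M) : ℝ :=
  ∫ t in a..b, energy m Ia (Set.Icc a b) c t

/-- `c` is a critical curve of the action among the curves in the unit tangent bundle with the same
endpoints: the first variation vanishes for every smooth variation with fixed endpoints. -/
def IsCritical (m Ia a b : ℝ) (c : ℝ → TangentBundle (𝓡 2) M) : Prop :=
  IsUnitCurve a b c ∧ ∀ ε C, IsVariation a b c ε C →
    HasDerivAt (fun s => action m Ia a b (C s)) 0 0

/-- The axial angular velocity `ωₐ = ⟨D_t u, J u⟩`, where `J` is the counterclockwise rotation by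
`π/2` for the orientation `o`. -/
def axialVelocity (o : ∀ x : M, Orientation ℝ (TangentSpace (𝓡 2) x) (Fin 2)) (T : Set ℝ)
    (c : ℝ → TangentBundle (𝓡 2) M) (t : ℝ) : ℝ :=
  ⟪covDeriv T (baseCurve c) (pointer c) t,
    (o (baseCurve c t)).rightAngleRotation (pointer c t)⟫

end Surface

end SpinningDisk

end

/-!
Near a time `t₀` the motion stays in the chart around `γ t₀`. Gram–Schmidt applied to the coordinate
vectors gives an orthonormal frame `e₁, e₂` there, which a sign `σ = ±1` makes oriented. Let
`A(v) = ⟨∇_v e₁, e₂⟩` be the connection form of the frame and `q` the coordinates of `γ`. If the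
pointer is `u = α e₁ + β e₂` with `α² + β² = 1`, then `D_t u = (r + A(q')) J u`, where
`r = α β' - β α'` is the rate of rotation of `u` relative to the frame
(`derivWithin_add_connection`). Hence `ω_a = r + A(q')` (`axialVelocity_eq`), and the action is the
integral of the Lagrangian `½ m g(q', q') + ½ I_a (r + A(q'))²` (`energy_eq_lagrangian`).

Take the variation `q + s f v` of the position, with a test function `f` and a constant vector `v`,
and at the same time turn the pointer by the angle `s κ f` in the moving frame, so that `r` becomes
`r + s κ f'`. The fundamental lemma of the calculus of variations then yields
(`IsFramedMetric.euler_lagrange`), with `v = 0`, that `ω_a` is constant, and with `κ = 0`, by the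
Koszul formula, that `m g(D_t γ', v) = I_a ω_a dA(v, γ')`. The structure equation
(`extDeriv₂_connForm`) identifies `dA(X, Y)` with `⟨R(X, Y) e₁, e₂⟩`, so that `dA = -K · area`
(`extDeriv₂_eq_neg_gaussianCurvature_mul`), and `area(γ', v) = ⟨J γ', v⟩` turns the equation into
the asserted one.

The covariant derivative at time `t` is defined in the chart around `γ t`, which changes with `t`.
The transformation law of the Christoffel symbols (`fderiv_transition_connection`) allows it to be
computed in one fixed chart (`covDeriv_eq`). The Gaussian curvature at a point is defined in the
chart around that point; therefore the chart around `γ t₀` is used at each `t₀`. Variations have to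
fix the endpoints, so the equations are first obtained at interior times near `t₀`; they extend to
`t₀` by continuity, also when `t₀` is an endpoint (`IsCritical.equations_at`). As `ω_a` has zero
derivative at every time, it is constant on the whole interval.
-/

noncomputable section

namespace SpinningDisk

set_option maxSynthPendingDepth 3

/-! ### Calculus of variations on an interval -/

section Calculus

open Set MeasureTheory Filter Topology

theorem exists_Ioo_superset_of_isCompact {a b : ℝ} (hab : a < b) {K : Set ℝ}
    (hK : IsCompact K) (hKab : K ⊆ Ioo a b) :
    ∃ c d, a < c ∧ c < d ∧ d < b ∧ K ⊆ Ioo c d := by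
  -- adding the midpoint makes the compact set nonempty
  have hK' : IsCompact (insert ((a + b) / 2) K) := hK.insert _
  have hne : (insert ((a + b) / 2) K).Nonempty := insert_nonempty _ _
  have hsub : insert ((a + b) / 2) K ⊆ Ioo a b :=
    insert_subset ⟨by linarith, by linarith⟩ hKab
  have h1 := hsub (hK'.sInf_mem hne)
  have h2 := hsub (hK'.sSup_mem hne)
  have h3 : sInf (insert ((a + b) / 2) K) ≤ (a + b) / 2 :=
    csInf_le hK'.bddBelow (mem_insert _ _)
  have h4 : (a + b) / 2 ≤ sSup (insert ((a + b) / 2) K) :=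
    le_csSup hK'.bddAbove (mem_insert _ _)
  refine ⟨(a + sInf (insert ((a + b) / 2) K)) / 2, (sSup (insert ((a + b) / 2) K) + b) / 2,
    by linarith [h1.1], by linarith [h1.1, h2.2], by linarith [h2.2], fun x hx => ⟨?_, ?_⟩⟩
  · linarith [csInf_le hK'.bddBelow (mem_insert_of_mem _ hx), h1.1]
  · linarith [le_csSup hK'.bddAbove (mem_insert_of_mem ((a + b) / 2) hx), h2.2]

/-- The lemma of du Bois-Reymond: if `∫ (P f + Q f') = 0` for every test function `f`, then
`P = Q'`. -/
theorem eq_deriv_of_forall_integral_eq_zero {a b : ℝ} {P Q : ℝ → ℝ}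
    (hP : ContinuousOn P (Ioo a b)) (hQ : ContDiffOn ℝ 1 Q (Ioo a b))
    (h : ∀ f : ℝ → ℝ, ContDiff ℝ ∞ f → ∀ c d, a < c → c < d → d < b → tsupport f ⊆ Ioo c d →
      ∫ t in c..d, (P t * f t + Q t * deriv f t) = 0) :
    ∀ t ∈ Ioo a b, P t = deriv Q t := by
  intro t₀ ht₀
  have hab : a < b := ht₀.1.trans ht₀.2
  have hQ' : ContinuousOn (deriv Q) (Ioo a b) :=
    hQ.continuousOn_deriv_of_isOpen isOpen_Ioo le_rfl
  have hc : ContinuousOn (fun t => P t - deriv Q t) (Ioo a b) := hP.sub hQ'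
  have key : ∀ᵐ x ∂volume, x ∈ Ioo a b → P x - deriv Q x = 0 := by
    refine isOpen_Ioo.ae_eq_zero_of_integral_contDiff_smul_eq_zero
      (hc.locallyIntegrableOn measurableSet_Ioo) fun f hf hfc hfs => ?_
    obtain ⟨c, d, hac, hcd, hdb, hsub⟩ := exists_Ioo_superset_of_isCompact hab hfc hfs
    have hIcc : uIcc c d ⊆ Ioo a b := by
      rw [uIcc_of_le hcd.le]; exact fun x hx => ⟨hac.trans_le hx.1, hx.2.trans_lt hdb⟩
    have hf' : Continuous (deriv f) := hf.continuous_deriv (by simp)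
    have hfc0 : f c = 0 := image_eq_zero_of_notMem_tsupport fun hx => lt_irrefl _ (hsub hx).1
    have hfd0 : f d = 0 := image_eq_zero_of_notMem_tsupport fun hx => lt_irrefl _ (hsub hx).2
    have hparts := intervalIntegral.integral_mul_deriv_eq_deriv_mul (a := c) (b := d)
      (u := Q) (v := f) (u' := deriv Q) (v' := deriv f)
      (fun x hx => ((hQ.differentiableOn one_ne_zero).differentiableAt
        (isOpen_Ioo.mem_nhds (hIcc hx))).hasDerivAt)
      (fun x _ => (hf.differentiable (by simp) x).hasDerivAt)
      (hQ'.mono hIcc).intervalIntegrable (hf'.intervalIntegrable _ _)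
    have h0 := h f hf c d hac hcd hdb hsub
    have hi1 : IntervalIntegrable (fun t => P t * f t) volume c d :=
      ((hP.mono hIcc).mul hf.continuous.continuousOn).intervalIntegrable
    have hi2 : IntervalIntegrable (fun t => Q t * deriv f t) volume c d :=
      ((hQ.continuousOn.mono hIcc).mul hf'.continuousOn).intervalIntegrable
    have hi3 : IntervalIntegrable (fun t => deriv Q t * f t) volume c d :=
      ((hQ'.mono hIcc).mul hf.continuous.continuousOn).intervalIntegrable
    rw [intervalIntegral.integral_add hi1 hi2, hparts, hfc0, hfd0] at h0
    have hsupp : Function.support (fun x => f x • (P x - deriv Q x)) ⊆ Ioc c d := by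
      intro x hx
      have : f x ≠ 0 := fun h => hx (by simp [h])
      exact Ioo_subset_Ioc_self (hsub (subset_tsupport f this))
    rw [← intervalIntegral.integral_eq_integral_of_support_subset hsupp]
    have : (fun x => f x • (P x - deriv Q x)) = fun x => P x * f x - deriv Q x * f x := by
      funext x; simp only [smul_eq_mul]; ring
    rw [this, intervalIntegral.integral_sub hi1 hi3]
    linarith
  have hae : (fun x => P x - deriv Q x) =ᵐ[volume.restrict (Ioo a b)] fun _ => (0 : ℝ) := by
    rw [EventuallyEq, ae_restrict_iff' measurableSet_Ioo]; exact key
  have := Measure.eqOn_of_ae_eq hae hc continuousOn_const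
    (by rw [isOpen_Ioo.interior_eq]; exact subset_closure) ht₀
  exact sub_eq_zero.1 this

theorem hasDerivAt_integral_of_contDiffOn {a b c d ε : ℝ} {F : ℝ → ℝ → ℝ} (hε : 0 < ε)
    (hF : ContDiffOn ℝ 1 (fun q : ℝ × ℝ => F q.1 q.2) (Ioo (-ε) ε ×ˢ Ioo a b))
    (hac : a < c) (hcd : c ≤ d) (hdb : d < b) :
    HasDerivAt (fun s => ∫ t in c..d, F s t) (∫ t in c..d, deriv (fun s => F s t) 0) 0 := by
  have hopen : IsOpen (Ioo (-ε) ε ×ˢ Ioo a b) := isOpen_Ioo.prod isOpen_Ioo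
  have hIcc : Icc c d ⊆ Ioo a b := fun x hx => ⟨hac.trans_le hx.1, hx.2.trans_lt hdb⟩
  have hder : ∀ s ∈ Ioo (-ε) ε, ∀ t ∈ Ioo a b, HasDerivAt (fun s => F s t)
      (fderiv ℝ (fun q : ℝ × ℝ => F q.1 q.2) (s, t) (1, 0)) s := by
    intro s hs t ht
    have h1 : HasFDerivAt (fun q : ℝ × ℝ => F q.1 q.2) _ (s, t) :=
      ((hF.differentiableOn one_ne_zero).differentiableAt
        (hopen.mem_nhds ⟨hs, ht⟩)).hasFDerivAt
    have h2 : HasDerivAt (fun s : ℝ => (s, t)) ((1 : ℝ), (0 : ℝ)) s :=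
      (hasDerivAt_id s).prodMk (hasDerivAt_const s t)
    exact h1.comp_hasDerivAt s h2
  have hcont : ContinuousOn (fun q : ℝ × ℝ =>
      fderiv ℝ (fun q : ℝ × ℝ => F q.1 q.2) q (1, 0)) (Ioo (-ε) ε ×ˢ Ioo a b) :=
    (hF.continuousOn_fderiv_of_isOpen hopen le_rfl).clm_apply continuousOn_const
  have hsub : Icc (-(ε / 2)) (ε / 2) ×ˢ Icc c d ⊆ Ioo (-ε) ε ×ˢ Ioo a b :=
    prod_mono (fun x hx => ⟨by linarith [hx.1], by linarith [hx.2]⟩) hIcc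
  obtain ⟨B, hB⟩ := (isCompact_Icc.prod isCompact_Icc).exists_bound_of_continuousOn
    (hcont.mono hsub)
  have h0 : (0 : ℝ) ∈ Ioo (-ε) ε := ⟨by linarith, hε⟩
  have hslice : ∀ s ∈ Ioo (-ε) ε, ContinuousOn (fun t => F s t) (Icc c d) := fun s hs =>
    hF.continuousOn.comp (f := fun t : ℝ => (s, t)) (by fun_prop) fun t ht => ⟨hs, hIcc ht⟩
  have huIoc : uIoc c d = Ioc c d := uIoc_of_le hcd
  have := intervalIntegral.hasDerivAt_integral_of_dominated_loc_of_deriv_le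
    (μ := volume) (a := c) (b := d) (F := F) (x₀ := 0) (s := Icc (-(ε / 2)) (ε / 2))
    (F' := fun s t => fderiv ℝ (fun q : ℝ × ℝ => F q.1 q.2) (s, t) (1, 0)) (bound := fun _ => B)
    (Icc_mem_nhds (by linarith) (by linarith))
    (by
      filter_upwards [isOpen_Ioo.mem_nhds h0] with s hs
      rw [huIoc]
      exact ((hslice s hs).mono Ioc_subset_Icc_self).aestronglyMeasurable measurableSet_Ioc)
    ((hslice 0 h0).intervalIntegrable_of_Icc hcd)
    (by
      rw [huIoc]
      refine ContinuousOn.aestronglyMeasurable ?_ measurableSet_Ioc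
      exact hcont.comp (f := fun t : ℝ => ((0 : ℝ), t)) (by fun_prop)
        fun t ht => ⟨h0, hIcc (Ioc_subset_Icc_self ht)⟩)
    (Eventually.of_forall fun t ht s hs =>
      hB (s, t) ⟨hs, Ioc_subset_Icc_self (huIoc ▸ ht)⟩)
    intervalIntegrable_const
    (Eventually.of_forall fun t ht s hs =>
      hder s ⟨by linarith [hs.1], by linarith [hs.2]⟩ t
        (hIcc (Ioc_subset_Icc_self (huIoc ▸ ht))))
  convert! this.2 using 1
  refine intervalIntegral.integral_congr fun t ht => ?_
  rw [uIcc_of_le hcd] at ht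
  exact (hder 0 h0 t (hIcc ht)).deriv

end Calculus

/-! ### Riemannian geometry of a framed coordinate domain -/

section Local

open Set Filter Topology

variable {E : Type*} [NormedAddCommGroup E] [NormedSpace ℝ E]
  {U : Set E} {g : E → E →L[ℝ] E →L[ℝ] ℝ} {Γ : E → E →L[ℝ] E →L[ℝ] E} {e₁ e₂ : E → E}

theorem hasDerivWithinAt_clm_apply {F : Type*} [NormedAddCommGroup F] [NormedSpace ℝ F]
    {B : ℝ → E →L[ℝ] F} {B' : E →L[ℝ] F} {x : ℝ → E} {x' : E} {t : ℝ} {T : Set ℝ}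
    (hB : HasDerivWithinAt B B' T t) (hx : HasDerivWithinAt x x' T t) :
    HasDerivWithinAt (fun s => B s (x s)) (B' (x t) + B t x') T t :=
  hB.clm_apply hx

theorem hasDerivWithinAt_clm_apply₂ {F : Type*} [NormedAddCommGroup F] [NormedSpace ℝ F]
    {B : ℝ → E →L[ℝ] E →L[ℝ] F} {B' : E →L[ℝ] E →L[ℝ] F} {x y : ℝ → E} {x' y' : E} {t : ℝ}
    {T : Set ℝ} (hB : HasDerivWithinAt B B' T t) (hx : HasDerivWithinAt x x' T t)
    (hy : HasDerivWithinAt y y' T t) :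
    HasDerivWithinAt (fun s => B s (x s) (y s))
      (B' (x t) (y t) + B t x' (y t) + B t (x t) y') T t := by
  have h1 : HasDerivWithinAt (fun s => B s (x s)) (B' (x t) + B t x') T t :=
    hasDerivWithinAt_clm_apply (F := E →L[ℝ] F) hB hx
  exact hasDerivWithinAt_clm_apply h1 hy

theorem hasDerivAt_clm_apply₂ {F : Type*} [NormedAddCommGroup F] [NormedSpace ℝ F]
    {B : ℝ → E →L[ℝ] E →L[ℝ] F} {B' : E →L[ℝ] E →L[ℝ] F} {x y : ℝ → E} {x' y' : E} {t : ℝ}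
    (hB : HasDerivAt B B' t) (hx : HasDerivAt x x' t) (hy : HasDerivAt y y' t) :
    HasDerivAt (fun s => B s (x s) (y s)) (B' (x t) (y t) + B t x' (y t) + B t (x t) y') t :=
  hasDerivWithinAt_univ.1 (hasDerivWithinAt_clm_apply₂ hB.hasDerivWithinAt
    hx.hasDerivWithinAt hy.hasDerivWithinAt)

/-- The covariant derivative `v ↦ ∇_v e = ∂_v e + Γ(v, e)` of a vector field `e` on a coordinate
domain, where `Γ` is the connection, written as a field of bilinear maps. -/
def covFDeriv (Γ : E → E →L[ℝ] E →L[ℝ] E) (e : E → E) (y : E) : E →L[ℝ] E :=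
  fderiv ℝ e y + (Γ y).flip (e y)

/-- The one-form `v ↦ g(∇_v e, f)`; for an orthonormal frame `e, f` this is its connection form. -/
def connForm (g : E → E →L[ℝ] E →L[ℝ] ℝ) (Γ : E → E →L[ℝ] E →L[ℝ] E) (e f : E → E) (y : E) :
    E →L[ℝ] ℝ :=
  ((g y).flip (f y)).comp (covFDeriv Γ e y)

/-- The curvature `R(X, Y)Z` at `y` of the connection `Γ`, for constant vector fields. -/
def curvature (Γ : E → E →L[ℝ] E →L[ℝ] E) (y X Y Z : E) : E :=
  fderiv ℝ Γ y X Y Z - fderiv ℝ Γ y Y X Z + Γ y X (Γ y Y Z) - Γ y Y (Γ y X Z)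

/-- The exterior derivative of a one-form, on two constant vector fields. -/
def extDeriv₂ (A : E → E →L[ℝ] ℝ) (y X Y : E) : ℝ :=
  fderiv ℝ A y X Y - fderiv ℝ A y Y X

theorem curvature_add_smul (y X Y : E) (r s : ℝ) (Z W : E) :
    curvature Γ y X Y (r • Z + s • W) = r • curvature Γ y X Y Z + s • curvature Γ y X Y W := by
  simp only [curvature, map_add, map_smul, smul_sub, smul_add]
  module

theorem covFDeriv_apply (e : E → E) (y v : E) :
    covFDeriv Γ e y v = fderiv ℝ e y v + Γ y v (e y) := rfl

theorem connForm_apply (e f : E → E) (y v : E) :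
    connForm g Γ e f y v = g y (covFDeriv Γ e y v) (f y) := rfl

theorem hasDerivAt_comp_line {F : Type*} [NormedAddCommGroup F] [NormedSpace ℝ F] {φ : E → F}
    {y : E} (h : DifferentiableAt ℝ φ y) (X : E) :
    HasDerivAt (fun s : ℝ => φ (y + s • X)) (fderiv ℝ φ y X) 0 := by
  have h1 : HasDerivAt (fun s : ℝ => y + s • X) X 0 := by
    simpa using ((hasDerivAt_id (0 : ℝ)).smul_const X).const_add y
  have h2 : HasFDerivAt φ (fderiv ℝ φ y) (y + (0 : ℝ) • X) := by simpa using h.hasFDerivAt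
  exact h2.comp_hasDerivAt (0 : ℝ) h1

theorem fderiv_metric_apply {y : E} (hg : DifferentiableAt ℝ g y)
    (hcompat : ∀ X Y Z, fderiv ℝ g y X Y Z = g y (Γ y X Y) Z + g y Y (Γ y X Z))
    {e f : E → E} (he : DifferentiableAt ℝ e y) (hf : DifferentiableAt ℝ f y) (v : E) :
    HasDerivAt (fun s : ℝ => g (y + s • v) (e (y + s • v)) (f (y + s • v)))
      (g y (covFDeriv Γ e y v) (f y) + g y (e y) (covFDeriv Γ f y v)) 0 := by
  refine (hasDerivAt_clm_apply₂ (hasDerivAt_comp_line hg v) (hasDerivAt_comp_line he v)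
    (hasDerivAt_comp_line hf v)).congr_deriv ?_
  simp only [covFDeriv_apply, hcompat, map_add, add_apply, zero_smul, add_zero]
  ring

theorem differentiableAt_flip {F : Type*} [NormedAddCommGroup F] [NormedSpace ℝ F]
    {B : E → E →L[ℝ] E →L[ℝ] F} {y : E} (hB : DifferentiableAt ℝ B y) :
    DifferentiableAt ℝ (fun z => (B z).flip) y :=
  (ContinuousLinearMap.differentiableAt (E := E →L[ℝ] E →L[ℝ] F) (F := E →L[ℝ] E →L[ℝ] F)
    ((ContinuousLinearMap.flipₗᵢ ℝ E E F).toContinuousLinearEquiv :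
      (E →L[ℝ] E →L[ℝ] F) →L[ℝ] (E →L[ℝ] E →L[ℝ] F))).comp (F := E →L[ℝ] E →L[ℝ] F) y hB

theorem differentiableAt_covFDeriv {y : E} (hΓ : DifferentiableAt ℝ Γ y) {e : E → E}
    (he : ContDiffAt ℝ 2 e y) : DifferentiableAt ℝ (covFDeriv Γ e) y := by
  have h1 : DifferentiableAt ℝ (fderiv ℝ e) y :=
    (he.fderiv_right (m := 1) (by norm_num)).differentiableAt one_ne_zero
  have h2 : DifferentiableAt ℝ e y := he.differentiableAt two_ne_zero
  have h3 : DifferentiableAt ℝ (fun z => (Γ z).flip) y :=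
    differentiableAt_flip hΓ
  exact h1.add (h3.clm_apply h2)

theorem differentiableAt_connForm {y : E} (hg : DifferentiableAt ℝ g y)
    (hΓ : DifferentiableAt ℝ Γ y) {e f : E → E}
    (he : ContDiffAt ℝ 2 e y) (hf : DifferentiableAt ℝ f y) :
    DifferentiableAt ℝ (connForm g Γ e f) y := by
  have h3 : DifferentiableAt ℝ (fun z => (g z).flip) y :=
    differentiableAt_flip hg
  exact (h3.clm_apply hf).clm_comp (differentiableAt_covFDeriv hΓ he)

/-- The structure equation: the exterior derivative of `g(∇e, f)` is the curvature up to
quadratic terms in the covariant derivatives. The second derivatives of `e` cancel by symmetry. -/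
theorem extDeriv₂_connForm {y : E} (hg : DifferentiableAt ℝ g y)
    (hcompat : ∀ X Y Z, fderiv ℝ g y X Y Z = g y (Γ y X Y) Z + g y Y (Γ y X Z))
    (hΓ : DifferentiableAt ℝ Γ y) {e f : E → E}
    (he : ContDiffAt ℝ 2 e y) (hf : DifferentiableAt ℝ f y) (X Y : E) :
    extDeriv₂ (connForm g Γ e f) y X Y = g y (curvature Γ y X Y (e y)) (f y)
      + g y (covFDeriv Γ e y Y) (covFDeriv Γ f y X)
      - g y (covFDeriv Γ e y X) (covFDeriv Γ f y Y) := by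
  have hde : DifferentiableAt ℝ (fderiv ℝ e) y :=
    (he.fderiv_right (m := 1) (by norm_num)).differentiableAt one_ne_zero
  have hd : DifferentiableAt ℝ e y := he.differentiableAt two_ne_zero
  have hsymm : ∀ X Y, fderiv ℝ (fderiv ℝ e) y X Y = fderiv ℝ (fderiv ℝ e) y Y X :=
    fun X Y => (he.isSymmSndFDerivAt (by simp)).eq X Y
  have key : ∀ X Y, fderiv ℝ (connForm g Γ e f) y X Y =
      g y (fderiv ℝ (fderiv ℝ e) y X Y + fderiv ℝ Γ y X Y (e y) + Γ y Y (fderiv ℝ e y X)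
        + Γ y X (covFDeriv Γ e y Y)) (f y) + g y (covFDeriv Γ e y Y) (covFDeriv Γ f y X) := by
    intro X Y
    have h1 := (hasDerivAt_comp_line (differentiableAt_connForm hg hΓ he hf) X).clm_apply
      (hasDerivAt_const (0 : ℝ) Y)
    have h5 := hasDerivAt_clm_apply₂ (hasDerivAt_comp_line hΓ X)
      (hasDerivAt_const (0 : ℝ) Y) (hasDerivAt_comp_line hd X)
    have h2 : HasDerivAt (fun s : ℝ => covFDeriv Γ e (y + s • X) Y) _ 0 :=
      ((hasDerivAt_comp_line hde X).clm_apply (hasDerivAt_const (0 : ℝ) Y)).add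
        h5
    have h3 := hasDerivAt_clm_apply₂ (hasDerivAt_comp_line hg X) h2 (hasDerivAt_comp_line hf X)
    have h4 := h1.unique h3
    simp only [zero_smul, add_zero, map_zero, zero_apply] at h4
    rw [h4, hcompat]
    simp only [covFDeriv_apply, map_add, add_apply]
    ring
  rw [extDeriv₂, key, key, hsymm X Y]
  simp only [curvature, covFDeriv_apply, map_add, map_sub, add_apply,
    sub_apply]
  ring

/-- A Riemannian metric `g` on a coordinate domain `U`, together with its Levi-Civita connection
`Γ` (characterised by the Koszul formula) and an orthonormal frame `e₁, e₂`, all of them smooth. -/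
structure IsFramedMetric (U : Set E) (g : E → E →L[ℝ] E →L[ℝ] ℝ) (Γ : E → E →L[ℝ] E →L[ℝ] E)
    (e₁ e₂ : E → E) : Prop where
  isOpen : IsOpen U
  contDiffOn_metric : ContDiffOn ℝ ∞ g U
  contDiffOn_connection : ContDiffOn ℝ ∞ Γ U
  contDiffOn_fst : ContDiffOn ℝ ∞ e₁ U
  contDiffOn_snd : ContDiffOn ℝ ∞ e₂ U
  symm : ∀ y ∈ U, ∀ X Y, g y X Y = g y Y X
  koszul : ∀ y ∈ U, ∀ X Y Z, 2 * g y (Γ y X Y) Z =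
    fderiv ℝ g y X Y Z + fderiv ℝ g y Y X Z - fderiv ℝ g y Z X Y
  fst_fst : ∀ y ∈ U, g y (e₁ y) (e₁ y) = 1
  snd_snd : ∀ y ∈ U, g y (e₂ y) (e₂ y) = 1
  fst_snd : ∀ y ∈ U, g y (e₁ y) (e₂ y) = 0
  expand : ∀ y ∈ U, ∀ X, g y X (e₁ y) • e₁ y + g y X (e₂ y) • e₂ y = X

/-- The oriented area of the parallelogram spanned by `X, Y`, for an oriented orthonormal
frame `e₁, e₂`. -/
def frameArea (g : E → E →L[ℝ] E →L[ℝ] ℝ) (e₁ e₂ : E → E) (y X Y : E) : ℝ :=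
  g y X (e₁ y) * g y Y (e₂ y) - g y X (e₂ y) * g y Y (e₁ y)

namespace IsFramedMetric

variable (h : IsFramedMetric U g Γ e₁ e₂) {y : E}
include h

theorem differentiableAt_metric (hy : y ∈ U) : DifferentiableAt ℝ g y :=
  (h.contDiffOn_metric.differentiableOn (by simp)).differentiableAt (h.isOpen.mem_nhds hy)

theorem differentiableAt_connection (hy : y ∈ U) : DifferentiableAt ℝ Γ y :=
  (h.contDiffOn_connection.differentiableOn (by simp)).differentiableAt (h.isOpen.mem_nhds hy)

theorem contDiffAt_fst (hy : y ∈ U) : ContDiffAt ℝ ∞ e₁ y :=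
  h.contDiffOn_fst.contDiffAt (h.isOpen.mem_nhds hy)

theorem contDiffAt_snd (hy : y ∈ U) : ContDiffAt ℝ ∞ e₂ y :=
  h.contDiffOn_snd.contDiffAt (h.isOpen.mem_nhds hy)

theorem differentiableAt_fst (hy : y ∈ U) : DifferentiableAt ℝ e₁ y :=
  (h.contDiffAt_fst hy).differentiableAt (by simp)

theorem differentiableAt_snd (hy : y ∈ U) : DifferentiableAt ℝ e₂ y :=
  (h.contDiffAt_snd hy).differentiableAt (by simp)

theorem fderiv_metric_symm (hy : y ∈ U) (X Y Z : E) :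
    fderiv ℝ g y X Y Z = fderiv ℝ g y X Z Y := by
  have hl : ∀ Y Z : E, HasDerivAt (fun s : ℝ => g (y + s • X) Y Z) (fderiv ℝ g y X Y Z) 0 := by
    intro Y Z
    simpa using hasDerivAt_clm_apply₂ (hasDerivAt_comp_line (h.differentiableAt_metric hy) X)
      (hasDerivAt_const (0 : ℝ) Y) (hasDerivAt_const (0 : ℝ) Z)
  refine (hl Y Z).unique ((hl Z Y).congr_of_eventuallyEq ?_)
  have : ∀ᶠ s : ℝ in 𝓝 0, y + s • X ∈ U := by
    have hc : Continuous fun s : ℝ => y + s • X := by fun_prop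
    exact hc.continuousAt.eventually_mem (h.isOpen.mem_nhds (by simpa using hy))
  filter_upwards [this] with s hs using h.symm _ hs Y Z

/-- The Levi-Civita connection is compatible with the metric. -/
theorem compat (hy : y ∈ U) (X Y Z : E) :
    fderiv ℝ g y X Y Z = g y (Γ y X Y) Z + g y Y (Γ y X Z) := by
  have h1 := h.koszul y hy X Y Z
  have h2 := h.koszul y hy X Z Y
  rw [h.symm y hy _ Y, h.fderiv_metric_symm hy X Z Y] at h2
  linarith

theorem metric_covFDeriv_add (hy : y ∈ U) {e f : E → E} (he : DifferentiableAt ℝ e y)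
    (hf : DifferentiableAt ℝ f y) {k : ℝ} (hk : ∀ z ∈ U, g z (e z) (f z) = k) (v : E) :
    g y (covFDeriv Γ e y v) (f y) + g y (e y) (covFDeriv Γ f y v) = 0 := by
  have h1 := fderiv_metric_apply (h.differentiableAt_metric hy) (h.compat hy) he hf v
  refine h1.unique ((hasDerivAt_const (0 : ℝ) k).congr_of_eventuallyEq ?_)
  have : ∀ᶠ s : ℝ in 𝓝 0, y + s • v ∈ U := by
    have hc : Continuous fun s : ℝ => y + s • v := by fun_prop
    exact hc.continuousAt.eventually_mem (h.isOpen.mem_nhds (by simpa using hy))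
  filter_upwards [this] with s hs using hk _ hs

theorem covFDeriv_fst (hy : y ∈ U) (v : E) :
    covFDeriv Γ e₁ y v = connForm g Γ e₁ e₂ y v • e₂ y := by
  have h1 := h.metric_covFDeriv_add hy (h.differentiableAt_fst hy) (h.differentiableAt_fst hy)
    h.fst_fst v
  rw [h.symm y hy (e₁ y)] at h1
  have h2 : g y (covFDeriv Γ e₁ y v) (e₁ y) = 0 := by linarith
  rw [connForm_apply]
  conv_lhs => rw [← h.expand y hy (covFDeriv Γ e₁ y v), h2, zero_smul, zero_add]

theorem metric_covFDeriv_snd_fst (hy : y ∈ U) (v : E) :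
    g y (covFDeriv Γ e₂ y v) (e₁ y) = - connForm g Γ e₁ e₂ y v := by
  have h1 := h.metric_covFDeriv_add hy (h.differentiableAt_fst hy) (h.differentiableAt_snd hy)
    h.fst_snd v
  rw [h.symm y hy (e₁ y)] at h1
  rw [connForm_apply]; linarith

theorem covFDeriv_snd (hy : y ∈ U) (v : E) :
    covFDeriv Γ e₂ y v = -(connForm g Γ e₁ e₂ y v • e₁ y) := by
  have h1 := h.metric_covFDeriv_add hy (h.differentiableAt_snd hy) (h.differentiableAt_snd hy)
    h.snd_snd v
  rw [h.symm y hy (e₂ y)] at h1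
  have h2 : g y (covFDeriv Γ e₂ y v) (e₂ y) = 0 := by linarith
  conv_lhs => rw [← h.expand y hy (covFDeriv Γ e₂ y v), h2, zero_smul, add_zero,
    h.metric_covFDeriv_snd_fst hy, neg_smul]

theorem metric_curvature_fst_snd (hy : y ∈ U) (X Y : E) :
    g y (curvature Γ y X Y (e₁ y)) (e₂ y) = extDeriv₂ (connForm g Γ e₁ e₂) y X Y := by
  rw [extDeriv₂_connForm (h.differentiableAt_metric hy) (h.compat hy)
    (h.differentiableAt_connection hy) ((h.contDiffAt_fst hy).of_le (by norm_cast))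
    (h.differentiableAt_snd hy)]
  simp only [h.covFDeriv_fst hy, h.covFDeriv_snd hy, map_smul, map_neg,
    smul_apply, smul_eq_mul, h.symm y hy (e₂ y) (e₁ y), h.fst_snd y hy]
  ring

theorem metric_curvature_snd_fst (hy : y ∈ U) (X Y : E) :
    g y (curvature Γ y X Y (e₂ y)) (e₁ y) = -extDeriv₂ (connForm g Γ e₁ e₂) y X Y := by
  have h1 := extDeriv₂_connForm (h.differentiableAt_metric hy) (h.compat hy)
    (h.differentiableAt_connection hy) ((h.contDiffAt_snd hy).of_le (by norm_cast))
    (h.differentiableAt_fst hy) X Y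
  have h2 : fderiv ℝ (connForm g Γ e₂ e₁) y = -fderiv ℝ (connForm g Γ e₁ e₂) y := by
    rw [← fderiv_neg]
    refine Filter.EventuallyEq.fderiv_eq ?_
    filter_upwards [h.isOpen.mem_nhds hy] with z hz
    ext v
    rw [connForm_apply, h.metric_covFDeriv_snd_fst hz]; rfl
  have h3 : extDeriv₂ (connForm g Γ e₂ e₁) y X Y = -extDeriv₂ (connForm g Γ e₁ e₂) y X Y := by
    simp only [extDeriv₂, h2, neg_apply]; ring
  rw [h3] at h1
  simp only [h.covFDeriv_fst hy, h.covFDeriv_snd hy, map_smul, map_neg,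
    smul_apply, neg_apply, smul_eq_mul, h.fst_snd y hy] at h1
  linarith

theorem metric_curvature_self_fst (hy : y ∈ U) (X Y : E) :
    g y (curvature Γ y X Y (e₁ y)) (e₁ y) = 0 := by
  have h1 := extDeriv₂_connForm (h.differentiableAt_metric hy) (h.compat hy)
    (h.differentiableAt_connection hy) ((h.contDiffAt_fst hy).of_le (by norm_cast))
    (h.differentiableAt_fst hy) X Y
  have h2 : fderiv ℝ (connForm g Γ e₁ e₁) y = 0 := by
    have : connForm g Γ e₁ e₁ =ᶠ[𝓝 y] fun _ => 0 := by
      filter_upwards [h.isOpen.mem_nhds hy] with z hz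
      ext v
      rw [connForm_apply, h.covFDeriv_fst hz, map_smul, smul_apply,
        h.symm z hz, h.fst_snd z hz]; simp
    rw [this.fderiv_eq]; simp
  have h3 : extDeriv₂ (connForm g Γ e₁ e₁) y X Y = 0 := by simp [extDeriv₂, h2]
  rw [h3] at h1
  simp only [h.covFDeriv_fst hy, map_smul,
    smul_apply, smul_eq_mul] at h1
  linarith

theorem metric_curvature_self_snd (hy : y ∈ U) (X Y : E) :
    g y (curvature Γ y X Y (e₂ y)) (e₂ y) = 0 := by
  have h1 := extDeriv₂_connForm (h.differentiableAt_metric hy) (h.compat hy)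
    (h.differentiableAt_connection hy) ((h.contDiffAt_snd hy).of_le (by norm_cast))
    (h.differentiableAt_snd hy) X Y
  have h2 : fderiv ℝ (connForm g Γ e₂ e₂) y = 0 := by
    have : connForm g Γ e₂ e₂ =ᶠ[𝓝 y] fun _ => 0 := by
      filter_upwards [h.isOpen.mem_nhds hy] with z hz
      ext v
      rw [connForm_apply, h.covFDeriv_snd hz, map_neg, map_smul, neg_apply,
        smul_apply, h.fst_snd z hz]; simp
    rw [this.fderiv_eq]; simp
  have h3 : extDeriv₂ (connForm g Γ e₂ e₂) y X Y = 0 := by simp [extDeriv₂, h2]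
  rw [h3] at h1
  simp only [h.covFDeriv_snd hy, map_smul, map_neg,
    smul_apply, neg_apply, smul_eq_mul] at h1
  linarith

/-- In dimension two the curvature operator `R(X, Y)` is a multiple of the rotation by `π/2`, the
factor being the exterior derivative of the connection form. -/
theorem metric_curvature (hy : y ∈ U) (X Y Z W : E) :
    g y (curvature Γ y X Y Z) W =
      extDeriv₂ (connForm g Γ e₁ e₂) y X Y * frameArea g e₁ e₂ y Z W := by
  have hZ := h.expand y hy Z
  have hW := h.expand y hy W
  rw [frameArea]
  conv_lhs => rw [← hZ, ← hW, curvature_add_smul]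
  simp only [map_add, map_smul, add_apply, smul_apply,
    smul_eq_mul, h.metric_curvature_fst_snd hy, h.metric_curvature_snd_fst hy,
    h.metric_curvature_self_fst hy, h.metric_curvature_self_snd hy]
  ring

theorem metric_eq (hy : y ∈ U) (X Y : E) :
    g y X Y = g y X (e₁ y) * g y Y (e₁ y) + g y X (e₂ y) * g y Y (e₂ y) := by
  conv_lhs => rw [← h.expand y hy Y]
  simp only [map_add, map_smul, smul_eq_mul]
  ring

/-- The Gram determinant is the square of the oriented area. -/
theorem gram_eq_frameArea_sq (hy : y ∈ U) (X Y : E) :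
    g y X X * g y Y Y - g y X Y * g y X Y = frameArea g e₁ e₂ y X Y ^ 2 := by
  rw [h.metric_eq hy X X, h.metric_eq hy Y Y, h.metric_eq hy X Y, frameArea]
  ring

/-- The covariant derivative of the vector field `α e₁ + β e₂` along a curve `q`. -/
theorem hasDerivWithinAt_frame {T : Set ℝ} {t : ℝ} {q : ℝ → E} {α β : ℝ → ℝ} {q' : E} {α' β' : ℝ}
    (hq : HasDerivWithinAt q q' T t) (hqU : q t ∈ U) (hα : HasDerivWithinAt α α' T t)
    (hβ : HasDerivWithinAt β β' T t) :
    HasDerivWithinAt (fun τ => α τ • e₁ (q τ) + β τ • e₂ (q τ))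
      ((α' - connForm g Γ e₁ e₂ (q t) q' * β t) • e₁ (q t)
        + (β' + connForm g Γ e₁ e₂ (q t) q' * α t) • e₂ (q t)
        - Γ (q t) q' (α t • e₁ (q t) + β t • e₂ (q t))) T t := by
  have h1 := (h.differentiableAt_fst hqU).hasFDerivAt.comp_hasDerivWithinAt t hq
  have h2 := (h.differentiableAt_snd hqU).hasFDerivAt.comp_hasDerivWithinAt t hq
  refine ((hα.smul h1).add (hβ.smul h2)).congr_deriv ?_
  have h3 := h.covFDeriv_fst hqU q'
  have h4 := h.covFDeriv_snd hqU q'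
  rw [covFDeriv_apply, ← eq_sub_iff_add_eq] at h3 h4
  simp only [h3, h4, map_add, map_smul, Function.comp]
  module

end IsFramedMetric

end Local

/-! ### The Euler–Lagrange equations in a framed coordinate domain -/

section EulerLagrange

open Set Filter Topology

variable {E : Type*} [NormedAddCommGroup E] [NormedSpace ℝ E]
  {U : Set E} {g : E → E →L[ℝ] E →L[ℝ] ℝ} {Γ : E → E →L[ℝ] E →L[ℝ] E} {e₁ e₂ : E → E}

/-- The kinetic energy of the disk in a framed coordinate domain, as a function of the position
`y`, the velocity `v` and the rate of rotation `r` of the pointer relative to the frame; `A` is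
the connection form of the frame. -/
def lagrangian (m Ia : ℝ) (g : E → E →L[ℝ] E →L[ℝ] ℝ) (A : E → E →L[ℝ] ℝ) (y v : E) (r : ℝ) : ℝ :=
  1 / 2 * m * g y v v + 1 / 2 * Ia * (r + A y v) ^ 2

theorem hasDerivAt_lagrangian (m Ia : ℝ) {A : E → E →L[ℝ] ℝ} {y : E}
    (hg : DifferentiableAt ℝ g y) (hA : DifferentiableAt ℝ A y) (v η ξ : E) (r κ : ℝ) :
    HasDerivAt (fun s : ℝ => lagrangian m Ia g A (y + s • η) (v + s • ξ) (r + s * κ))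
      (1 / 2 * m * (fderiv ℝ g y η v v + g y ξ v + g y v ξ)
        + Ia * (r + A y v) * (κ + (fderiv ℝ A y η v + A y ξ))) 0 := by
  have hv : HasDerivAt (fun s : ℝ => v + s • ξ) ξ 0 := by
    simpa using ((hasDerivAt_id (0 : ℝ)).smul_const ξ).const_add v
  have hr : HasDerivAt (fun s : ℝ => r + s * κ) κ 0 := by
    simpa using ((hasDerivAt_id (0 : ℝ)).mul_const κ).const_add r
  have h1 := hasDerivAt_clm_apply₂ (hasDerivAt_comp_line hg η) hv hv
  have h2 := (hasDerivAt_comp_line hA η).clm_apply hv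
  refine ((h1.const_mul (1 / 2 * m)).add
    (((hr.add h2).pow 2).const_mul (1 / 2 * Ia))).congr_deriv ?_
  simp only [zero_smul, add_zero, zero_mul, Pi.add_apply]
  ring

theorem contDiffOn_connForm (h : IsFramedMetric U g Γ e₁ e₂) :
    ContDiffOn ℝ ∞ (connForm g Γ e₁ e₂) U := by
  have h1 : ContDiffOn ℝ ∞ (fun z => (g z).flip) U :=
    (ContinuousLinearMap.flipₗᵢ ℝ E E ℝ).contDiff.comp_contDiffOn h.contDiffOn_metric
  have h2 : ContDiffOn ℝ ∞ (fun z => (Γ z).flip) U :=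
    (ContinuousLinearMap.flipₗᵢ ℝ E E E).contDiff.comp_contDiffOn h.contDiffOn_connection
  have h3 : ContDiffOn ℝ ∞ (fderiv ℝ e₁) U :=
    h.contDiffOn_fst.fderiv_of_isOpen h.isOpen (by simp)
  exact (h1.clm_apply h.contDiffOn_snd).clm_comp (h3.add (h2.clm_apply h.contDiffOn_fst))

/-- The Euler–Lagrange equations. If the first variation vanishes for all variations
`q + s f v` of the position and `r + s κ f'` of the rate of rotation, with a test function `f` and
constant `v`, `κ`, then the axial angular velocity `r + A(q')` is constant, and the covariant
acceleration is determined by the exterior derivative of the connection form `A`. -/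
theorem IsFramedMetric.euler_lagrange (h : IsFramedMetric U g Γ e₁ e₂) {m Ia a b : ℝ}
    (hIa : Ia ≠ 0) {q : ℝ → E} {r : ℝ → ℝ} (hq : ContDiffOn ℝ ∞ q (Ioo a b))
    (hqU : ∀ t ∈ Ioo a b, q t ∈ U) (hr : ContDiffOn ℝ ∞ r (Ioo a b))
    (hcrit : ∀ (v : E) (κ : ℝ) (f : ℝ → ℝ), ContDiff ℝ ∞ f → ∀ c d, a < c → c < d → d < b →
      tsupport f ⊆ Ioo c d →
      ∫ t in c..d, deriv (fun s => lagrangian m Ia g (connForm g Γ e₁ e₂) (q t + s • (f t • v))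
        (deriv q t + s • (deriv f t • v)) (r t + s * (κ * deriv f t))) 0 = 0) :
    ∀ t ∈ Ioo a b,
      deriv (fun τ => r τ + connForm g Γ e₁ e₂ (q τ) (deriv q τ)) t = 0 ∧
      ∀ v, m * g (q t) (deriv (deriv q) t + Γ (q t) (deriv q t) (deriv q t)) v =
        Ia * (r t + connForm g Γ e₁ e₂ (q t) (deriv q t)) *
          extDeriv₂ (connForm g Γ e₁ e₂) (q t) v (deriv q t) := by
  set A := connForm g Γ e₁ e₂ with hAdef
  have hA := contDiffOn_connForm h
  rw [← hAdef] at hA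
  have hq' : ContDiffOn ℝ ∞ (deriv q) (Ioo a b) := hq.deriv_of_isOpen isOpen_Ioo (by simp)
  have hgq : ContDiffOn ℝ ∞ (fun t => g (q t)) (Ioo a b) := h.contDiffOn_metric.comp hq hqU
  have hAq : ContDiffOn ℝ ∞ (fun t => A (q t)) (Ioo a b) := hA.comp hq hqU
  have hdg : ContDiffOn ℝ ∞ (fun t => fderiv ℝ g (q t)) (Ioo a b) :=
    (h.contDiffOn_metric.fderiv_of_isOpen h.isOpen (by simp)).comp hq hqU
  have hdA : ContDiffOn ℝ ∞ (fun t => fderiv ℝ A (q t)) (Ioo a b) :=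
    (hA.fderiv_of_isOpen h.isOpen (by simp)).comp hq hqU
  have hA' : ∀ t ∈ Ioo a b, DifferentiableAt ℝ A (q t) := fun t ht =>
    (hA.differentiableOn (by simp)).differentiableAt (h.isOpen.mem_nhds (hqU t ht))
  set w : ℝ → ℝ := fun τ => r τ + A (q τ) (deriv q τ) with hw
  have hwC : ContDiffOn ℝ ∞ w (Ioo a b) := hr.add (hAq.clm_apply hq')
  -- the first variation is `∫ (P f + Q f')`
  let P : E → ℝ → ℝ := fun v t =>
    1 / 2 * m * fderiv ℝ g (q t) v (deriv q t) (deriv q t)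
      + Ia * w t * fderiv ℝ A (q t) v (deriv q t)
  let Q : E → ℝ → ℝ → ℝ := fun v κ t => m * g (q t) (deriv q t) v + Ia * w t * (κ + A (q t) v)
  have hP : ∀ v, ContinuousOn (P v) (Ioo a b) := fun v =>
    (((contDiffOn_const.mul (((hdg.clm_apply contDiffOn_const).clm_apply hq').clm_apply hq')).add
      ((contDiffOn_const.mul hwC).mul
        ((hdA.clm_apply contDiffOn_const).clm_apply hq'))).continuousOn)
  have hQ : ∀ v κ, ContDiffOn ℝ 1 (Q v κ) (Ioo a b) := fun v κ =>
    (((contDiffOn_const.mul ((hgq.clm_apply hq').clm_apply contDiffOn_const)).add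
      ((contDiffOn_const.mul hwC).mul
        (contDiffOn_const.add (hAq.clm_apply contDiffOn_const)))).of_le (by norm_cast))
  have hEL : ∀ v κ, ∀ t ∈ Ioo a b, P v t = deriv (Q v κ) t := by
    intro v κ
    refine eq_deriv_of_forall_integral_eq_zero (hP v) (hQ v κ) fun f hf c d hac hcd hdb hfs => ?_
    rw [← hcrit v κ f hf c d hac hcd hdb hfs]
    refine intervalIntegral.integral_congr fun t ht => ?_
    rw [uIcc_of_le hcd.le] at ht
    have htI : t ∈ Ioo a b := ⟨hac.trans_le ht.1, ht.2.trans_lt hdb⟩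
    rw [(hasDerivAt_lagrangian m Ia (h.differentiableAt_metric (hqU t htI)) (hA' t htI)
      (deriv q t) (f t • v) (deriv f t • v) (r t) (κ * deriv f t)).deriv]
    simp only [P, Q, hw, map_smul, smul_apply, smul_eq_mul, h.symm _ (hqU t htI) v]
    ring
  intro t ht
  have hnhds := isOpen_Ioo.mem_nhds ht
  have hdw : HasDerivAt w (deriv w t) t :=
    ((hwC.differentiableOn (by simp)).differentiableAt hnhds).hasDerivAt
  have hdq : HasDerivAt q (deriv q t) t :=
    ((hq.differentiableOn (by simp)).differentiableAt hnhds).hasDerivAt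
  have hdq' : HasDerivAt (deriv q) (deriv (deriv q) t) t :=
    ((hq'.differentiableOn (by simp)).differentiableAt hnhds).hasDerivAt
  have hdgq : HasDerivAt (fun τ => g (q τ)) (fderiv ℝ g (q t) (deriv q t)) t :=
    (h.differentiableAt_metric (hqU t ht)).hasFDerivAt.comp_hasDerivAt t hdq
  have hdAq : HasDerivAt (fun τ => A (q τ)) (fderiv ℝ A (q t) (deriv q t)) t :=
    (hA' t ht).hasFDerivAt.comp_hasDerivAt t hdq
  have hw0 : deriv w t = 0 := by
    have h1 := hEL 0 1 t ht
    have h2 : Q 0 1 = fun τ => Ia * w τ := by funext τ; simp [Q]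
    have h3 : P 0 t = 0 := by simp [P]
    rw [h3, h2, (hdw.const_mul Ia).deriv] at h1
    exact (mul_eq_zero.1 h1.symm).resolve_left hIa
  refine ⟨hw0, fun v => ?_⟩
  have h1 := hEL v 0 t ht
  have h2 : HasDerivAt (Q v 0) _ t :=
    ((hasDerivAt_clm_apply₂ hdgq hdq' (hasDerivAt_const t v)).const_mul m).add
      ((hdw.const_mul Ia).mul
        ((hdAq.clm_apply (hasDerivAt_const t v)).const_add 0))
  rw [h2.deriv, hw0] at h1
  simp only [P, map_zero, mul_zero, zero_mul, add_zero, zero_add] at h1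
  have h4 := h.koszul (q t) (hqU t ht) (deriv q t) (deriv q t) v
  change _ = Ia * w t * _
  rw [extDeriv₂, map_add, add_apply]
  linear_combination (-1 : ℝ) * h1 + (1 / 2 * m) * h4

end EulerLagrange

/-! ### The metric and its connection in a chart -/

section Chart

open Set Filter Topology

variable {M : Type*} [TopologicalSpace M] [ChartedSpace Plane M]

/-- The `i`-th standard basis vector of the model plane. -/
abbrev stdVec (i : Fin 2) : Plane := EuclideanSpace.single i 1

/-- The bilinear form `(X, Y) ↦ Xⁱ Yʲ`. -/
def coordBilin (i j : Fin 2) : Plane →L[ℝ] Plane →L[ℝ] ℝ :=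
  (EuclideanSpace.proj i : Plane →L[ℝ] ℝ).smulRight (EuclideanSpace.proj j : Plane →L[ℝ] ℝ)

theorem coordBilin_apply (i j : Fin 2) (X Y : Plane) : coordBilin i j X Y = X i * Y j := rfl

theorem plane_eq (X : Plane) : X = X 0 • stdVec 0 + X 1 • stdVec 1 := by
  ext i; fin_cases i <;> simp [stdVec]

theorem fderiv_apply_eq_sum_pderiv (f : Plane → ℝ) (y X : Plane) :
    fderiv ℝ f y X = X 0 * pderiv 0 f y + X 1 * pderiv 1 f y := by
  conv_lhs => rw [plane_eq X]
  simp [pderiv, stdVec]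

theorem extChartAt_symm_mem {p : M} {y : Plane} (hy : y ∈ (extChartAt (𝓡 2) p).target) :
    (extChartAt (𝓡 2) p).symm y ∈ (chartAt Plane p).source := by
  rw [← extChartAt_source (𝓡 2)]; exact (extChartAt (𝓡 2) p).map_target hy

theorem contDiffOn_pderiv {p : M} {f : Plane → ℝ} (i : Fin 2)
    (hf : ContDiffOn ℝ ∞ f (extChartAt (𝓡 2) p).target) :
    ContDiffOn ℝ ∞ (pderiv i f) (extChartAt (𝓡 2) p).target :=
  (hf.fderiv_of_isOpen (isOpen_extChartAt_target p) (by simp)).clm_apply contDiffOn_const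

variable [IsManifold (𝓡 2) ∞ M]

/-- The linear map that sends a tangent vector at `x` to its components in the chart around `p`. -/
def toCoord (p x : M) : TangentSpace (𝓡 2) x →L[ℝ] Plane :=
  (trivializationAt Plane (TangentSpace (𝓡 2) : M → Type _) p).continuousLinearMapAt ℝ x

/-- The linear map that sends components in the chart around `p` to a tangent vector at `x`. -/
def ofCoord (p x : M) : Plane →L[ℝ] TangentSpace (𝓡 2) x :=
  (trivializationAt Plane (TangentSpace (𝓡 2) : M → Type _) p).symmL ℝ x

theorem toCoord_ofCoord {p x : M} (hx : x ∈ (chartAt Plane p).source) (X : Plane) :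
    toCoord p x (ofCoord p x X) = X :=
  Trivialization.continuousLinearMapAt_symmL _ hx X

theorem ofCoord_toCoord {p x : M} (hx : x ∈ (chartAt Plane p).source)
    (X : TangentSpace (𝓡 2) x) : ofCoord p x (toCoord p x X) = X :=
  Trivialization.symmL_continuousLinearMapAt _ hx X

theorem toCoord_apply {p x : M} (hx : x ∈ (chartAt Plane p).source) (X : TangentSpace (𝓡 2) x) :
    toCoord p x X = (trivializationAt Plane (TangentSpace (𝓡 2) : M → Type _) p ⟨x, X⟩).2 :=
  Trivialization.continuousLinearMapAt_apply_of_mem (R := ℝ)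
    (trivializationAt Plane (TangentSpace (𝓡 2) : M → Type _) p) hx X

theorem contMDiffOn_coordVec (p : M) (i : Fin 2) :
    ContMDiffOn (𝓡 2) (𝓡 2).tangent ∞
      (fun x => (⟨x, coordVec p x i⟩ : TangentBundle (𝓡 2) M)) (chartAt Plane p).source := by
  have h := (trivializationAt Plane (TangentSpace (𝓡 2) : M → Type _)
    p).contMDiffOn_section_baseSet_iff (IB := 𝓡 2) (n := ∞) (s := fun x => coordVec p x i)
  refine h.2 ((contMDiffOn_const (c := stdVec i)).congr fun x hx => ?_)
  exact (toCoord_apply (p := p) hx _).symm.trans (toCoord_ofCoord hx (stdVec i))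

variable [RiemannianBundle (fun x : M => TangentSpace (𝓡 2) x)]

/-- The metric in the chart around `p`, as a field of bilinear forms. -/
def metricForm (p : M) (y : Plane) : Plane →L[ℝ] Plane →L[ℝ] ℝ :=
  ∑ i, ∑ j, metricCoeff p y i j • coordBilin i j

/-- The Levi-Civita connection in the chart around `p`, as a field of bilinear maps. -/
def connection (p : M) (y : Plane) : Plane →L[ℝ] Plane →L[ℝ] Plane :=
  ∑ k, ∑ i, ∑ j, christoffel p k i j y •
    (ContinuousLinearMap.compL ℝ Plane ℝ Plane (ContinuousLinearMap.toSpanSingleton ℝ (stdVec k))).comp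
      (coordBilin i j)

theorem metricForm_apply_sum (p : M) (y X Y : Plane) :
    metricForm p y X Y = ∑ i, ∑ j, metricCoeff p y i j * (X i * Y j) := by
  simp [metricForm, coordBilin_apply]

theorem connection_apply (p : M) (y X Y : Plane) (k : Fin 2) :
    connection p y X Y k = ∑ i, ∑ j, christoffel p k i j y * (X i * Y j) := by
  fin_cases k <;>
  simp [connection, coordBilin_apply, stdVec]

theorem metricForm_apply (p : M) (y X Y : Plane) :
    metricForm p y X Y = ⟪ofCoord p ((extChartAt (𝓡 2) p).symm y) X,
      ofCoord p ((extChartAt (𝓡 2) p).symm y) Y⟫ := by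
  rw [metricForm_apply_sum]
  conv_rhs => rw [plane_eq X, plane_eq Y]
  simp only [map_add, map_smul, inner_add_left, inner_add_right, real_inner_smul_left,
    real_inner_smul_right, Fin.sum_univ_two, metricCoeff, coordVec, Matrix.of_apply, ofCoord]
  ring

theorem metricForm_extChartAt {p x : M} (hx : x ∈ (chartAt Plane p).source) (X Y : Plane) :
    metricForm p (extChartAt (𝓡 2) p x) X Y = ⟪ofCoord p x X, ofCoord p x Y⟫ := by
  rw [metricForm_apply, (extChartAt (𝓡 2) p).left_inv (by rwa [extChartAt_source])]

theorem metricForm_symm (p : M) (y X Y : Plane) : metricForm p y X Y = metricForm p y Y X := by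
  rw [metricForm_apply, metricForm_apply, real_inner_comm]

theorem metricForm_pos {p : M} {y : Plane} (hy : y ∈ (extChartAt (𝓡 2) p).target) {X : Plane}
    (hX : X ≠ 0) : 0 < metricForm p y X X := by
  rw [metricForm_apply, real_inner_self_eq_norm_sq]
  refine pow_pos (norm_pos_iff.2 fun h0 => hX ?_) 2
  rw [← toCoord_ofCoord (extChartAt_symm_mem hy) X, h0, map_zero]

theorem metricCoeff_eq (p : M) (y : Plane) (i j : Fin 2) :
    metricCoeff p y i j = metricForm p y (stdVec i) (stdVec j) := by
  rw [metricForm_apply]; rfl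

theorem metricCoeff_symm (p : M) (y : Plane) (i j : Fin 2) :
    metricCoeff p y i j = metricCoeff p y j i := by
  rw [metricCoeff_eq, metricForm_symm, ← metricCoeff_eq]

theorem metricCoeff_zero_zero_pos {p : M} {y : Plane} (hy : y ∈ (extChartAt (𝓡 2) p).target) :
    0 < metricCoeff p y 0 0 := by
  rw [metricCoeff_eq]; exact metricForm_pos hy (by simp [stdVec])

theorem det_metricCoeff_pos {p : M} {y : Plane} (hy : y ∈ (extChartAt (𝓡 2) p).target) :
    0 < (metricCoeff p y).det := by
  have h0 := metricCoeff_zero_zero_pos hy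
  -- the square of the component of `∂₁` orthogonal to `∂₀` is `det / g₀₀`
  have h1 := metricForm_pos hy (X := metricCoeff p y 0 0 • stdVec 1 - metricCoeff p y 0 1 • stdVec 0)
    (by
      intro h
      have := congrArg (fun v : Plane => v 1) h
      simp [stdVec] at this
      exact h0.ne' this)
  have h2 := metricCoeff_symm p y 1 0
  simp only [map_sub, map_smul, sub_apply, smul_apply, ← metricCoeff_eq, smul_eq_mul, h2] at h1
  rw [Matrix.det_fin_two, h2]
  nlinarith

/-- Lowering the upper index of the Christoffel symbols. -/
theorem sum_christoffel_mul_metricCoeff {p : M} {y : Plane}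
    (hy : y ∈ (extChartAt (𝓡 2) p).target) (i j l : Fin 2) :
    2 * ∑ k, christoffel p k i j y * metricCoeff p y k l =
      pderiv i (fun z => metricCoeff p z j l) y + pderiv j (fun z => metricCoeff p z i l) y
        - pderiv l (fun z => metricCoeff p z i j) y := by
  have hdet : IsUnit (metricCoeff p y).det := (det_metricCoeff_pos hy).ne'.isUnit
  have hmul := Matrix.mul_nonsing_inv _ hdet
  have key : ∀ l n, ∑ k, (metricCoeff p y)⁻¹ k n * metricCoeff p y k l = if l = n then 1 else 0 := by
    intro l n
    rw [← Matrix.one_apply, ← hmul, Matrix.mul_apply]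
    exact Finset.sum_congr rfl fun k _ => by rw [metricCoeff_symm p y k l, mul_comm]
  have h0 := key l 0
  have h1 := key l 1
  simp only [Fin.sum_univ_two, christoffel] at h0 h1 ⊢
  fin_cases l <;> simp at h0 h1 ⊢ <;> linear_combination
    (pderiv i (fun z => metricCoeff p z j 0) y + pderiv j (fun z => metricCoeff p z i 0) y
      - pderiv 0 (fun z => metricCoeff p z i j) y) * h0
    + (pderiv i (fun z => metricCoeff p z j 1) y + pderiv j (fun z => metricCoeff p z i 1) y
      - pderiv 1 (fun z => metricCoeff p z i j) y) * h1

variable [IsContMDiffRiemannianBundle (𝓡 2) ∞ Plane (fun x : M => TangentSpace (𝓡 2) x)]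

theorem contDiffOn_metricCoeff (p : M) (i j : Fin 2) :
    ContDiffOn ℝ ∞ (fun y => metricCoeff p y i j) (extChartAt (𝓡 2) p).target := by
  have h : ContMDiffOn (𝓡 2) 𝓘(ℝ, ℝ) ∞ (fun x => ⟪coordVec p x i, coordVec p x j⟫)
      (chartAt Plane p).source :=
    ContMDiffOn.inner_bundle (contMDiffOn_coordVec p i) (contMDiffOn_coordVec p j)
  rw [← contMDiffOn_iff_contDiffOn]
  exact h.comp (contMDiffOn_extChartAt_symm p) fun y hy => extChartAt_symm_mem hy

theorem contDiffOn_metricForm (p : M) :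
    ContDiffOn ℝ ∞ (metricForm p) (extChartAt (𝓡 2) p).target := by
  unfold metricForm
  exact ContDiffOn.sum fun i _ => ContDiffOn.sum fun j _ =>
    (contDiffOn_metricCoeff p i j).smul contDiffOn_const

theorem contDiffOn_inv_metricCoeff (p : M) (i j : Fin 2) :
    ContDiffOn ℝ ∞ (fun y => (metricCoeff p y)⁻¹ i j) (extChartAt (𝓡 2) p).target := by
  have hdet : ContDiffOn ℝ ∞ (fun y => (metricCoeff p y).det) (extChartAt (𝓡 2) p).target := by
    simp only [Matrix.det_fin_two]
    exact ((contDiffOn_metricCoeff p 0 0).mul (contDiffOn_metricCoeff p 1 1)).sub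
      ((contDiffOn_metricCoeff p 0 1).mul (contDiffOn_metricCoeff p 1 0))
  have hinv := hdet.inv fun y hy => (det_metricCoeff_pos hy).ne'
  have hadj : ContDiffOn ℝ ∞ (fun y => (metricCoeff p y).adjugate i j)
      (extChartAt (𝓡 2) p).target := by
    simp only [Matrix.adjugate_fin_two]
    fin_cases i <;> fin_cases j
    exacts [contDiffOn_metricCoeff p 1 1, (contDiffOn_metricCoeff p 0 1).neg,
      (contDiffOn_metricCoeff p 1 0).neg, contDiffOn_metricCoeff p 0 0]
  simp only [Matrix.inv_def, Ring.inverse_eq_inv', Matrix.smul_apply, smul_eq_mul]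
  exact hinv.mul hadj

theorem contDiffOn_christoffel (p : M) (k i j : Fin 2) :
    ContDiffOn ℝ ∞ (christoffel p k i j) (extChartAt (𝓡 2) p).target := by
  unfold christoffel
  exact contDiffOn_const.mul (ContDiffOn.sum fun l _ => (contDiffOn_inv_metricCoeff p k l).mul
    (((contDiffOn_pderiv i (contDiffOn_metricCoeff p j l)).add
      (contDiffOn_pderiv j (contDiffOn_metricCoeff p i l))).sub
      (contDiffOn_pderiv l (contDiffOn_metricCoeff p i j))))

theorem contDiffOn_connection (p : M) :
    ContDiffOn ℝ ∞ (connection p) (extChartAt (𝓡 2) p).target := by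
  unfold connection
  exact ContDiffOn.sum fun k _ => ContDiffOn.sum fun i _ => ContDiffOn.sum fun j _ =>
    (contDiffOn_christoffel p k i j).smul contDiffOn_const

theorem fderiv_metricForm {p : M} {y : Plane} (hy : y ∈ (extChartAt (𝓡 2) p).target)
    (X Y Z : Plane) :
    fderiv ℝ (metricForm p) y X Y Z =
      ∑ j, ∑ l, fderiv ℝ (fun z => metricCoeff p z j l) y X * (Y j * Z l) := by
  have hm : ∀ i j, DifferentiableAt ℝ (fun z => metricCoeff p z i j) y := fun i j =>
    ((contDiffOn_metricCoeff p i j).differentiableOn (by simp)).differentiableAt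
      ((isOpen_extChartAt_target p).mem_nhds hy)
  have h : HasFDerivAt (metricForm p) (∑ j, ∑ l,
      (fderiv ℝ (fun z => metricCoeff p z j l) y).smulRight (coordBilin j l)) y := by
    unfold metricForm
    exact HasFDerivAt.fun_sum fun i _ => HasFDerivAt.fun_sum fun j _ =>
      (hm i j).hasFDerivAt.smul_const _
  rw [h.fderiv]
  simp [coordBilin_apply]

theorem fderiv_connection {p : M} {y : Plane} (hy : y ∈ (extChartAt (𝓡 2) p).target)
    (X Y Z : Plane) (k : Fin 2) :
    fderiv ℝ (connection p) y X Y Z k =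
      ∑ i, ∑ j, fderiv ℝ (christoffel p k i j) y X * (Y i * Z j) := by
  have hm : ∀ k i j, DifferentiableAt ℝ (christoffel p k i j) y := fun k i j =>
    ((contDiffOn_christoffel p k i j).differentiableOn (by simp)).differentiableAt
      ((isOpen_extChartAt_target p).mem_nhds hy)
  have h : HasFDerivAt (connection p) (∑ k, ∑ i, ∑ j,
      (fderiv ℝ (christoffel p k i j) y).smulRight ((ContinuousLinearMap.compL ℝ Plane ℝ Plane
        (ContinuousLinearMap.toSpanSingleton ℝ (stdVec k))).comp (coordBilin i j))) y := by
    unfold connection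
    exact HasFDerivAt.fun_sum fun k _ => HasFDerivAt.fun_sum fun i _ =>
      HasFDerivAt.fun_sum fun j _ => (hm k i j).hasFDerivAt.smul_const _
  rw [h.fderiv]
  fin_cases k <;>
  simp [coordBilin_apply, stdVec]

/-- The Christoffel symbols are those of the Levi-Civita connection: the Koszul formula for constant
vector fields. -/
theorem koszul_connection {p : M} {y : Plane} (hy : y ∈ (extChartAt (𝓡 2) p).target)
    (X Y Z : Plane) :
    2 * metricForm p y (connection p y X Y) Z = fderiv ℝ (metricForm p) y X Y Z
      + fderiv ℝ (metricForm p) y Y X Z - fderiv ℝ (metricForm p) y Z X Y := by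
  have h := sum_christoffel_mul_metricCoeff hy
  have h000 := h 0 0 0
  have h001 := h 0 0 1
  have h010 := h 0 1 0
  have h011 := h 0 1 1
  have h100 := h 1 0 0
  have h101 := h 1 0 1
  have h110 := h 1 1 0
  have h111 := h 1 1 1
  simp only [fderiv_metricForm hy, fderiv_apply_eq_sum_pderiv, metricForm_apply_sum,
    connection_apply, Fin.sum_univ_two] at *
  linear_combination X 0 * Y 0 * Z 0 * h000 + X 0 * Y 0 * Z 1 * h001 + X 0 * Y 1 * Z 0 * h010
    + X 0 * Y 1 * Z 1 * h011 + X 1 * Y 0 * Z 0 * h100 + X 1 * Y 0 * Z 1 * h101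
    + X 1 * Y 1 * Z 0 * h110 + X 1 * Y 1 * Z 1 * h111

/-- The Gram–Schmidt frame of the coordinate vectors: first vector. -/
def frameFst (p : M) (y : Plane) : Plane := (√(metricCoeff p y 0 0))⁻¹ • stdVec 0

/-- The Gram–Schmidt frame of the coordinate vectors: second vector, multiplied by a sign `σ`
that adapts the frame to a given orientation. -/
def frameSnd (σ : ℝ) (p : M) (y : Plane) : Plane :=
  (σ * (√(metricCoeff p y).det)⁻¹ * (√(metricCoeff p y 0 0))⁻¹) •
    (metricCoeff p y 0 0 • stdVec 1 - metricCoeff p y 0 1 • stdVec 0)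

theorem isFramedMetric (p : M) {σ : ℝ} (hσ : σ ^ 2 = 1) :
    IsFramedMetric (extChartAt (𝓡 2) p).target (metricForm p) (connection p)
      (frameFst p) (frameSnd σ p) := by
  have hc : ContDiffOn ℝ ∞ (fun y => (√(metricCoeff p y 0 0))⁻¹) (extChartAt (𝓡 2) p).target :=
    ((contDiffOn_metricCoeff p 0 0).sqrt fun y hy => (metricCoeff_zero_zero_pos hy).ne').inv
      fun y hy => (Real.sqrt_pos.2 (metricCoeff_zero_zero_pos hy)).ne'
  have hdet : ContDiffOn ℝ ∞ (fun y => (metricCoeff p y).det) (extChartAt (𝓡 2) p).target := by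
    simp only [Matrix.det_fin_two]
    exact ((contDiffOn_metricCoeff p 0 0).mul (contDiffOn_metricCoeff p 1 1)).sub
      ((contDiffOn_metricCoeff p 0 1).mul (contDiffOn_metricCoeff p 1 0))
  have hd : ContDiffOn ℝ ∞ (fun y => (√(metricCoeff p y).det)⁻¹) (extChartAt (𝓡 2) p).target :=
    (hdet.sqrt fun y hy => (det_metricCoeff_pos hy).ne').inv
      fun y hy => (Real.sqrt_pos.2 (det_metricCoeff_pos hy)).ne'
  have hsq : ∀ y ∈ (extChartAt (𝓡 2) p).target,
      (√(metricCoeff p y 0 0))⁻¹ ^ 2 * metricCoeff p y 0 0 = 1 := fun y hy => by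
    rw [inv_pow, Real.sq_sqrt (metricCoeff_zero_zero_pos hy).le,
      inv_mul_cancel₀ (metricCoeff_zero_zero_pos hy).ne']
  have hsd : ∀ y ∈ (extChartAt (𝓡 2) p).target, (√(metricCoeff p y).det)⁻¹ ^ 2 *
      (metricCoeff p y 0 0 * metricCoeff p y 1 1 - metricCoeff p y 0 1 * metricCoeff p y 0 1) = 1 :=
    fun y hy => by
      have := Matrix.det_fin_two (metricCoeff p y)
      rw [metricCoeff_symm p y 1 0] at this
      rw [← this, inv_pow, Real.sq_sqrt (det_metricCoeff_pos hy).le,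
        inv_mul_cancel₀ (det_metricCoeff_pos hy).ne']
  refine ⟨isOpen_extChartAt_target p, contDiffOn_metricForm p, contDiffOn_connection p,
    hc.smul contDiffOn_const, ((contDiffOn_const.mul hd).mul hc).smul
      (((contDiffOn_metricCoeff p 0 0).smul contDiffOn_const).sub
        ((contDiffOn_metricCoeff p 0 1).smul contDiffOn_const)),
    fun y _ X Y => metricForm_symm p y X Y, fun y hy => koszul_connection hy, ?_, ?_, ?_, ?_⟩
  · intro y hy
    simp only [frameFst, map_smul, smul_apply, ← metricCoeff_eq, smul_eq_mul]
    linear_combination hsq y hy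
  · intro y hy
    simp only [frameSnd, map_smul, map_sub, smul_apply, sub_apply, ← metricCoeff_eq, smul_eq_mul,
      metricCoeff_symm p y 1 0]
    linear_combination (√(metricCoeff p y 0 0))⁻¹ ^ 2 * metricCoeff p y 0 0 *
      (√(metricCoeff p y).det)⁻¹ ^ 2 * (metricCoeff p y 0 0 * metricCoeff p y 1 1
        - metricCoeff p y 0 1 * metricCoeff p y 0 1) * hσ + hsq y hy * (√(metricCoeff p y).det)⁻¹ ^ 2
        * (metricCoeff p y 0 0 * metricCoeff p y 1 1
        - metricCoeff p y 0 1 * metricCoeff p y 0 1) + hsd y hy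
  · intro y hy
    simp only [frameFst, frameSnd, map_smul, map_sub, smul_apply, ← metricCoeff_eq, smul_eq_mul]
    ring
  · intro y hy X
    have h1 := hsq y hy
    have h2 := hsd y hy
    have hg := metricCoeff_symm p y 1 0
    have h3 : metricForm p y X (frameFst p y) = (√(metricCoeff p y 0 0))⁻¹ *
        (X 0 * metricCoeff p y 0 0 + X 1 * metricCoeff p y 0 1) := by
      conv_lhs => rw [plane_eq X, frameFst]
      simp only [map_smul, map_add, smul_apply, add_apply, ← metricCoeff_eq, smul_eq_mul, hg]
    have h4 : metricForm p y X (frameSnd σ p y) =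
        (σ * (√(metricCoeff p y).det)⁻¹ * (√(metricCoeff p y 0 0))⁻¹) * (X 1 *
        (metricCoeff p y 0 0 * metricCoeff p y 1 1 - metricCoeff p y 0 1 * metricCoeff p y 0 1)) := by
      conv_lhs => rw [plane_eq X, frameSnd]
      simp only [map_smul, map_add, map_sub, smul_apply, add_apply, ← metricCoeff_eq, smul_eq_mul,
        hg]
      ring
    have h5 : σ ^ 2 * ((√(metricCoeff p y).det)⁻¹ ^ 2 *
      (metricCoeff p y 0 0 * metricCoeff p y 1 1 - metricCoeff p y 0 1 * metricCoeff p y 0 1)) = 1 := by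
      rw [hσ, h2, one_mul]
    rw [h3, h4, frameFst, frameSnd]
    ext i
    fin_cases i
    · simp [stdVec]
      linear_combination (X 0) * h1 - (X 1) * metricCoeff p y 0 1 *
        (√(metricCoeff p y 0 0))⁻¹ ^ 2 * h5
    · simp [stdVec]
      linear_combination (X 1) * h1 + (X 1) * metricCoeff p y 0 0 *
        (√(metricCoeff p y 0 0))⁻¹ ^ 2 * h5

theorem curvature_connection {p : M} {y : Plane} (hy : y ∈ (extChartAt (𝓡 2) p).target)
    (l k i j : Fin 2) :
    curvature (connection p) y (stdVec i) (stdVec j) (stdVec k) l = riemannCoeff p l k i j y := by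
  have hstd : ∀ i j : Fin 2, (stdVec i) j = if j = i then (1 : ℝ) else 0 := fun i j => by
    simp [stdVec]
  simp only [curvature, PiLp.add_apply, PiLp.sub_apply, fderiv_connection hy, connection_apply,
    hstd, riemannCoeff]
  simp [pderiv, Finset.sum_sub_distrib, mul_comm]
  ring

/-- Gaussian curvature is the exterior derivative of the connection form, up to sign. -/
theorem extDeriv₂_eq_neg_gaussianCurvature_mul (x : M) {σ : ℝ} (hσ : σ ^ 2 = 1) (X Y : Plane) :
    extDeriv₂ (connForm (metricForm x) (connection x) (frameFst x) (frameSnd σ x))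
        (extChartAt (𝓡 2) x x) X Y =
      -(gaussianCurvature x * frameArea (metricForm x) (frameFst x) (frameSnd σ x)
        (extChartAt (𝓡 2) x x) X Y) := by
  have hy : extChartAt (𝓡 2) x x ∈ (extChartAt (𝓡 2) x).target := mem_extChartAt_target x
  have h := isFramedMetric x hσ
  set y := extChartAt (𝓡 2) x x
  set A := connForm (metricForm x) (connection x) (frameFst x) (frameSnd σ x)
  set Ω := frameArea (metricForm x) (frameFst x) (frameSnd σ x) y with hΩ
  have hdet : (metricCoeff x y).det = Ω (stdVec 0) (stdVec 1) ^ 2 := by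
    rw [hΩ, ← h.gram_eq_frameArea_sq hy, Matrix.det_fin_two, metricCoeff_symm x y 1 0]
    simp only [metricCoeff_eq]
  have hpos := det_metricCoeff_pos hy
  have hne : Ω (stdVec 0) (stdVec 1) ≠ 0 := fun h0 => by rw [hdet, h0] at hpos; simp at hpos
  have hR := h.metric_curvature hy (stdVec 0) (stdVec 1) (stdVec 1) (stdVec 0)
  have hK : gaussianCurvature x * Ω (stdVec 0) (stdVec 1) =
      - extDeriv₂ A y (stdVec 0) (stdVec 1) := by
    have h1 : gaussianCurvature x = (metricForm x y (curvature (connection x) y (stdVec 0)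
        (stdVec 1) (stdVec 1)) (stdVec 0)) / (metricCoeff x y).det := by
      rw [gaussianCurvature, metricForm_apply_sum]
      simp only [curvature_connection hy]
      simp [Fin.sum_univ_two, stdVec, y]
      ring
    have h2 : Ω (stdVec 1) (stdVec 0) = - Ω (stdVec 0) (stdVec 1) := by
      simp only [hΩ, frameArea]; ring
    rw [h1, hR, hdet]
    change extDeriv₂ A y _ _ * Ω _ _ / _ * _ = _
    rw [h2]
    field_simp
  have hX : ∀ X Y : Plane, extDeriv₂ A y X Y =
      (X 0 * Y 1 - X 1 * Y 0) * extDeriv₂ A y (stdVec 0) (stdVec 1) := by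
    intro X Y
    conv_lhs => rw [plane_eq X, plane_eq Y]
    simp only [extDeriv₂, map_add, map_smul, add_apply, smul_apply, smul_eq_mul]
    ring
  have hΩX : Ω X Y = (X 0 * Y 1 - X 1 * Y 0) * Ω (stdVec 0) (stdVec 1) := by
    conv_lhs => rw [plane_eq X, plane_eq Y]
    simp only [hΩ, frameArea, map_add, map_smul, add_apply, smul_apply, smul_eq_mul]
    ring
  rw [hX, hΩX]
  linear_combination (X 0 * Y 1 - X 1 * Y 0) * hK

end Chart

/-! ### Independence of the chart -/

section Transition

open Set Filter Topology

theorem hasDerivWithinAt_comp_curve {E F : Type*} [NormedAddCommGroup E] [NormedSpace ℝ E]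
    [NormedAddCommGroup F] [NormedSpace ℝ F] {φ : E → F} {q : ℝ → E} {q' : E} {T : Set ℝ} {t : ℝ}
    (hφ : DifferentiableAt ℝ φ (q t)) (hq : HasDerivWithinAt q q' T t) :
    HasDerivWithinAt (fun τ => φ (q τ)) (fderiv ℝ φ (q t) q') T t :=
  hφ.hasFDerivAt.comp_hasDerivWithinAt t hq

variable {M : Type*} [TopologicalSpace M] [ChartedSpace Plane M]

/-- The change of coordinates from the chart around `p` to the chart around `p'`. -/
def transition (p p' : M) : Plane → Plane :=
  extChartAt (𝓡 2) p' ∘ (extChartAt (𝓡 2) p).symm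

theorem transition_extChartAt {p x : M} (p' : M) (hx : x ∈ (chartAt Plane p).source) :
    transition p p' (extChartAt (𝓡 2) p x) = extChartAt (𝓡 2) p' x := by
  rw [transition, Function.comp, (extChartAt (𝓡 2) p).left_inv (by rwa [extChartAt_source])]

theorem eventually_transition_mem {p p' x : M} (hx : x ∈ (chartAt Plane p).source)
    (hx' : x ∈ (chartAt Plane p').source) :
    ∀ᶠ y in 𝓝 (extChartAt (𝓡 2) p x), y ∈ (extChartAt (𝓡 2) p).target ∧
      (extChartAt (𝓡 2) p).symm y ∈ (chartAt Plane p').source := by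
  have hx0 : x ∈ (extChartAt (𝓡 2) p).source := by rwa [extChartAt_source]
  refine Filter.Eventually.and (extChartAt_target_mem_nhds' (I := 𝓡 2)
    ((extChartAt (𝓡 2) p).map_source hx0)) ?_
  refine (continuousAt_extChartAt_symm' hx0).eventually_mem ?_
  rw [(extChartAt (𝓡 2) p).left_inv hx0]
  exact (chartAt Plane p').open_source.mem_nhds hx'

variable [IsManifold (𝓡 2) ∞ M]

theorem contDiffAt_transition {p p' x : M} (hx : x ∈ (chartAt Plane p).source)
    (hx' : x ∈ (chartAt Plane p').source) :
    ContDiffAt ℝ ∞ (transition p p') (extChartAt (𝓡 2) p x) := by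
  have h := contDiffWithinAt_ext_coord_change (I := 𝓡 2) (n := ∞) p' p
    (y := extChartAt (𝓡 2) p x) (by
      rw [PartialEquiv.trans_source'', PartialEquiv.symm_symm, PartialEquiv.symm_target]
      exact mem_image_of_mem _ ⟨by rwa [extChartAt_source], by rwa [extChartAt_source]⟩)
  rwa [modelWithCornersSelf_coe, range_id, contDiffWithinAt_univ] at h

theorem toCoord_eq_fderiv_transition {p p' x : M} (hx : x ∈ (chartAt Plane p).source)
    (hx' : x ∈ (chartAt Plane p').source) (X : TangentSpace (𝓡 2) x) :
    toCoord p' x X = fderiv ℝ (transition p p') (extChartAt (𝓡 2) p x) (toCoord p x X) := by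
  have h1 : ∀ {b₀ : M}, x ∈ (chartAt Plane b₀).source →
      toCoord b₀ x X = tangentCoordChange (𝓡 2) x b₀ x X := fun hb => by
    rw [toCoord, TangentBundle.continuousLinearMapAt_trivializationAt_eq_core hb]
    rfl
  have h2 : fderiv ℝ (transition p p') (extChartAt (𝓡 2) p x) =
      tangentCoordChange (𝓡 2) p p' x := by
    rw [tangentCoordChange_def]; simp [transition, fderivWithin_univ]
  rw [h1 hx, h1 hx', h2]
  exact (tangentCoordChange_comp (I := 𝓡 2) ⟨⟨mem_extChartAt_source x, by rwa [extChartAt_source]⟩,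
    by rwa [extChartAt_source]⟩).symm

theorem ofCoord_fderiv_transition {p p' x : M} (hx : x ∈ (chartAt Plane p).source)
    (hx' : x ∈ (chartAt Plane p').source) (Y : Plane) :
    ofCoord p' x (fderiv ℝ (transition p p') (extChartAt (𝓡 2) p x) Y) = ofCoord p x Y := by
  rw [← ofCoord_toCoord hx' (ofCoord p x Y), toCoord_eq_fderiv_transition hx hx',
    toCoord_ofCoord hx]

theorem toCoord_velocity {T : Set ℝ} {t : ℝ} {γ : ℝ → M} {p : M} (hT : UniqueDiffWithinAt ℝ T t)
    (hγ : MDifferentiableWithinAt 𝓘(ℝ, ℝ) (𝓡 2) γ T t) (hp : γ t ∈ (chartAt Plane p).source) :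
    toCoord p (γ t) (velocity T γ t) = derivWithin (fun τ => extChartAt (𝓡 2) p (γ τ)) T t := by
  have h1 : MDifferentiableAt (𝓡 2) 𝓘(ℝ, Plane) (extChartAt (𝓡 2) p) (γ t) :=
    mdifferentiableAt_extChartAt hp
  have h2 := mfderiv_comp_mfderivWithin t h1 hγ hT.uniqueMDiffWithinAt
  rw [toCoord, TangentBundle.continuousLinearMapAt_trivializationAt hp, velocity]
  rw [mfderivWithin_eq_fderivWithin] at h2
  exact (congrArg (fun L : ℝ →L[ℝ] Plane => L 1) h2).symm

theorem differentiableWithinAt_extChartAt_comp {T : Set ℝ} {t : ℝ} {γ : ℝ → M} {p : M}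
    (hγ : MDifferentiableWithinAt 𝓘(ℝ, ℝ) (𝓡 2) γ T t) (hp : γ t ∈ (chartAt Plane p).source) :
    DifferentiableWithinAt ℝ (fun τ => extChartAt (𝓡 2) p (γ τ)) T t := by
  have h1 : MDifferentiableAt (𝓡 2) 𝓘(ℝ, Plane) (extChartAt (𝓡 2) p) (γ t) :=
    mdifferentiableAt_extChartAt hp
  exact (h1.comp_mdifferentiableWithinAt t hγ).differentiableWithinAt

variable [RiemannianBundle (fun x : M => TangentSpace (𝓡 2) x)]

theorem metricForm_transition {p p' : M} {y : Plane} (hy : y ∈ (extChartAt (𝓡 2) p).target)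
    (hy' : (extChartAt (𝓡 2) p).symm y ∈ (chartAt Plane p').source) (Y Z : Plane) :
    metricForm p y Y Z = metricForm p' (transition p p' y) (fderiv ℝ (transition p p') y Y)
      (fderiv ℝ (transition p p') y Z) := by
  have hx := extChartAt_symm_mem hy
  have h1 : extChartAt (𝓡 2) p ((extChartAt (𝓡 2) p).symm y) = y :=
    (extChartAt (𝓡 2) p).right_inv hy
  have h2 : transition p p' y = extChartAt (𝓡 2) p' ((extChartAt (𝓡 2) p).symm y) := rfl
  have h3 := ofCoord_fderiv_transition hx hy'
  rw [h1] at h3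
  rw [h2, metricForm_extChartAt hy', h3, h3, metricForm_apply]

variable [IsContMDiffRiemannianBundle (𝓡 2) ∞ Plane (fun x : M => TangentSpace (𝓡 2) x)]

/-- The transformation law of the Christoffel symbols under a change of coordinates. -/
theorem fderiv_transition_connection {p p' x : M} (hx : x ∈ (chartAt Plane p).source)
    (hx' : x ∈ (chartAt Plane p').source) (X Y : Plane) :
    fderiv ℝ (transition p p') (extChartAt (𝓡 2) p x)
        (connection p (extChartAt (𝓡 2) p x) X Y) =
      connection p' (extChartAt (𝓡 2) p' x)
        (fderiv ℝ (transition p p') (extChartAt (𝓡 2) p x) X)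
        (fderiv ℝ (transition p p') (extChartAt (𝓡 2) p x) Y)
      + fderiv ℝ (fderiv ℝ (transition p p')) (extChartAt (𝓡 2) p x) X Y := by
  have hφ := contDiffAt_transition hx hx'
  have hφy := transition_extChartAt p' hx
  have hev := eventually_transition_mem hx hx'
  have hx0 : extChartAt (𝓡 2) p x ∈ (extChartAt (𝓡 2) p).target := hev.self_of_nhds.1
  have hx0' : extChartAt (𝓡 2) p' x ∈ (extChartAt (𝓡 2) p').target :=
    (extChartAt (𝓡 2) p').map_source (by rwa [extChartAt_source])
  have hofc := ofCoord_fderiv_transition hx hx'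
  have htoc := toCoord_eq_fderiv_transition hx hx'
  have hg := (isFramedMetric p (one_pow 2)).differentiableAt_metric hx0
  have hg' := (isFramedMetric p' (one_pow 2)).differentiableAt_metric hx0'
  have hmet := metricForm_transition hev.self_of_nhds.1 hev.self_of_nhds.2
  set y := extChartAt (𝓡 2) p x
  set y' := extChartAt (𝓡 2) p' x
  set φ := transition p p'
  have hdφ : DifferentiableAt ℝ φ y := hφ.differentiableAt (by simp)
  have hddφ : DifferentiableAt ℝ (fderiv ℝ φ) y :=
    (hφ.fderiv_right (m := 1) (by norm_cast)).differentiableAt one_ne_zero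
  have hsymm : ∀ X Y, fderiv ℝ (fderiv ℝ φ) y X Y = fderiv ℝ (fderiv ℝ φ) y Y X :=
    fun X Y => ((hφ.of_le (m := 2) (by norm_cast)).isSymmSndFDerivAt (by simp)).eq X Y
  have hder : ∀ X Y Z, fderiv ℝ (metricForm p) y X Y Z =
      fderiv ℝ (metricForm p') y' (fderiv ℝ φ y X) (fderiv ℝ φ y Y) (fderiv ℝ φ y Z)
      + metricForm p' y' (fderiv ℝ (fderiv ℝ φ) y X Y) (fderiv ℝ φ y Z)
      + metricForm p' y' (fderiv ℝ φ y Y) (fderiv ℝ (fderiv ℝ φ) y X Z) := by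
    intro X Y Z
    have h1 : HasDerivAt (fun s : ℝ => metricForm p (y + s • X) Y Z)
        (fderiv ℝ (metricForm p) y X Y Z) 0 := by
      simpa using hasDerivAt_clm_apply₂ (hasDerivAt_comp_line hg X)
        (hasDerivAt_const (0 : ℝ) Y) (hasDerivAt_const (0 : ℝ) Z)
    have hline : HasDerivAt (fun s : ℝ => metricForm p' (φ (y + s • X)))
        (fderiv ℝ (metricForm p') y' (fderiv ℝ φ y X)) 0 := by
      have := hasDerivAt_comp_line hdφ X
      have h0 : HasFDerivAt (metricForm p') (fderiv ℝ (metricForm p') y')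
          (φ (y + (0 : ℝ) • X)) := by
        rw [zero_smul, add_zero, hφy]; exact hg'.hasFDerivAt
      exact h0.comp_hasDerivAt (0 : ℝ) this
    have hlin : ∀ Y, HasDerivAt (fun s : ℝ => fderiv ℝ φ (y + s • X) Y)
        (fderiv ℝ (fderiv ℝ φ) y X Y) 0 := by
      intro Y
      simpa using (hasDerivAt_comp_line hddφ X).clm_apply (hasDerivAt_const (0 : ℝ) Y)
    have h2 := hasDerivAt_clm_apply₂ hline (hlin Y) (hlin Z)
    simp only [zero_smul, add_zero, hφy] at h2
    refine h1.unique (h2.congr_of_eventuallyEq ?_)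
    have hc : Tendsto (fun s : ℝ => y + s • X) (𝓝 0) (𝓝 y) := by
      have : Continuous fun s : ℝ => y + s • X := by fun_prop
      simpa using this.tendsto 0
    filter_upwards [hc.eventually hev] with s hs using metricForm_transition hs.1 hs.2 Y Z
  -- the difference of the two sides is orthogonal to every vector, hence to itself
  set d := fderiv ℝ φ y (connection p y X Y) - (connection p' y' (fderiv ℝ φ y X) (fderiv ℝ φ y Y)
    + fderiv ℝ (fderiv ℝ φ) y X Y) with hd
  have horth : ∀ Z, metricForm p' y' d (fderiv ℝ φ y Z) = 0 := by
    intro Z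
    have k1 := koszul_connection hx0 X Y Z
    have k2 := koszul_connection hx0' (fderiv ℝ φ y X) (fderiv ℝ φ y Y) (fderiv ℝ φ y Z)
    rw [hder, hder, hder, hmet, hφy] at k1
    rw [hsymm Y X, hsymm Z X, hsymm Z Y] at k1
    have s1 := metricForm_symm p' y' (fderiv ℝ φ y Y) (fderiv ℝ (fderiv ℝ φ) y X Z)
    rw [hd, map_sub, map_add, sub_apply, add_apply]
    linear_combination (1 / 2) * k1 - (1 / 2) * k2
      + (1 / 2) * s1
  have hd0 : d = fderiv ℝ φ y (toCoord p x (ofCoord p' x d)) := by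
    rw [← htoc, toCoord_ofCoord hx']
  by_contra hne
  have hpos := metricForm_pos hx0' (X := d) (sub_ne_zero.2 hne)
  have := horth (toCoord p x (ofCoord p' x d))
  rw [← hd0] at this
  exact hpos.ne' this

/-- The covariant derivative along a curve may be computed in any chart. -/
theorem covDeriv_eq {T : Set ℝ} {t : ℝ} {γ : ℝ → M} {X : ∀ t, TangentSpace (𝓡 2) (γ t)} {p : M}
    (hT : UniqueDiffWithinAt ℝ T t)
    (hγ : MDifferentiableWithinAt 𝓘(ℝ, ℝ) (𝓡 2) γ T t) (hp : γ t ∈ (chartAt Plane p).source)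
    (hX : DifferentiableWithinAt ℝ (fun τ => toCoord p (γ τ) (X τ)) T t) :
    covDeriv T γ X t = ofCoord p (γ t) (derivWithin (fun τ => toCoord p (γ τ) (X τ)) T t
      + connection p (extChartAt (𝓡 2) p (γ t)) (derivWithin (fun τ => extChartAt (𝓡 2) p (γ τ)) T t)
        (toCoord p (γ t) (X t))) := by
  have hp' : γ t ∈ (chartAt Plane (γ t)).source := mem_chart_source Plane (γ t)
  have hφ := contDiffAt_transition hp hp'
  have hev : ∀ᶠ τ in 𝓝[T] t, γ τ ∈ (chartAt Plane p).source ∧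
      γ τ ∈ (chartAt Plane (γ t)).source :=
    (hγ.continuousWithinAt.eventually_mem ((chartAt Plane p).open_source.mem_nhds hp)).and
      (hγ.continuousWithinAt.eventually_mem ((chartAt Plane (γ t)).open_source.mem_nhds hp'))
  have hq := (differentiableWithinAt_extChartAt_comp hγ hp).hasDerivWithinAt
  have hddφ : DifferentiableAt ℝ (fderiv ℝ (transition p (γ t))) (extChartAt (𝓡 2) p (γ t)) :=
    (hφ.fderiv_right (m := 1) (by norm_cast)).differentiableAt one_ne_zero
  -- the derivative of the components of `X` in the chart around `γ t`
  have hXd : HasDerivWithinAt (fun τ => toCoord (γ t) (γ τ) (X τ))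
      (fderiv ℝ (fderiv ℝ (transition p (γ t))) (extChartAt (𝓡 2) p (γ t))
        (derivWithin (fun τ => extChartAt (𝓡 2) p (γ τ)) T t) (toCoord p (γ t) (X t))
      + fderiv ℝ (transition p (γ t)) (extChartAt (𝓡 2) p (γ t))
        (derivWithin (fun τ => toCoord p (γ τ) (X τ)) T t)) T t := by
    have h0 : HasDerivWithinAt
        (fun τ => fderiv ℝ (transition p (γ t)) (extChartAt (𝓡 2) p (γ τ)))
        (fderiv ℝ (fderiv ℝ (transition p (γ t))) (extChartAt (𝓡 2) p (γ t))
          (derivWithin (fun τ => extChartAt (𝓡 2) p (γ τ)) T t)) T t :=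
      hasDerivWithinAt_comp_curve (q := fun τ => extChartAt (𝓡 2) p (γ τ)) hddφ hq
    have h1 := hasDerivWithinAt_clm_apply h0 hX.hasDerivWithinAt
    refine h1.congr_of_eventuallyEq ?_ (toCoord_eq_fderiv_transition hp hp' _)
    filter_upwards [hev] with τ hτ using toCoord_eq_fderiv_transition hτ.1 hτ.2 _
  have hqd : toCoord (γ t) (γ t) (velocity T γ t) =
      fderiv ℝ (transition p (γ t)) (extChartAt (𝓡 2) p (γ t))
        (derivWithin (fun τ => extChartAt (𝓡 2) p (γ τ)) T t) := by
    rw [toCoord_eq_fderiv_transition hp hp', toCoord_velocity hT hγ hp]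
  have hdef : covDeriv T γ X t = ofCoord (γ t) (γ t)
      (derivWithin (fun τ => toCoord (γ t) (γ τ) (X τ)) T t
      + connection (γ t) (extChartAt (𝓡 2) (γ t) (γ t)) (toCoord (γ t) (γ t) (velocity T γ t))
        (toCoord (γ t) (γ t) (X t))) := by
    have hcomp : ∀ k, derivWithin (fun τ => SpinningDisk.comp (γ t) (γ τ) (X τ) k) T t =
        derivWithin (fun τ => toCoord (γ t) (γ τ) (X τ)) T t k := by
      intro k
      have := ((EuclideanSpace.proj k : Plane →L[ℝ] ℝ).hasFDerivAt).comp_hasDerivWithinAt t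
        hXd.differentiableWithinAt.hasDerivWithinAt
      exact this.derivWithin hT
    conv_rhs => rw [plane_eq (derivWithin (fun τ => toCoord (γ t) (γ τ) (X τ)) T t
      + connection (γ t) (extChartAt (𝓡 2) (γ t) (γ t)) (toCoord (γ t) (γ t) (velocity T γ t))
        (toCoord (γ t) (γ t) (X t)))]
    rw [covDeriv, Fin.sum_univ_two]
    simp only [hcomp, map_add, map_smul, PiLp.add_apply, connection_apply, mul_assoc]
    rfl
  rw [hdef, hXd.derivWithin hT, hqd, toCoord_eq_fderiv_transition hp hp',
    ← ofCoord_fderiv_transition hp hp', map_add (fderiv ℝ _ _),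
    fderiv_transition_connection hp hp']
  congr 1
  abel

end Transition

/-! ### The motion of the disk in a chart -/

section Motion

open Set Filter Topology

/-- On a relatively open part of `T`, the derivative within `T` of a smooth curve is smooth. -/
theorem contDiffOn_derivWithin_inter {F : Type*} [NormedAddCommGroup F] [NormedSpace ℝ F]
    {T V : Set ℝ} (hT : UniqueDiffOn ℝ T) (hV : IsOpen V) {q : ℝ → F}
    (hq : ContDiffOn ℝ ∞ q (T ∩ V)) : ContDiffOn ℝ ∞ (derivWithin q T) (T ∩ V) := by
  refine (hq.derivWithin (m := ∞) (hT.inter hV) (by simp)).congr fun t ht => ?_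
  exact (derivWithin_inter (hV.mem_nhds ht.2)).symm

variable {M : Type*} [TopologicalSpace M] [ChartedSpace Plane M]

/-- The coordinates of the base point of a tangent vector, in the chart around `p`. -/
def chartPos (p : M) (z : TangentBundle (𝓡 2) M) : Plane := extChartAt (𝓡 2) p z.proj

theorem chartPos_mem {p : M} {z : TangentBundle (𝓡 2) M} (hz : z.proj ∈ (chartAt Plane p).source) :
    chartPos p z ∈ (extChartAt (𝓡 2) p).target :=
  (extChartAt (𝓡 2) p).map_source (by rwa [extChartAt_source])

variable [IsManifold (𝓡 2) ∞ M]

/-- The components of a tangent vector, in the chart around `p`. -/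
def chartVec (p : M) (z : TangentBundle (𝓡 2) M) : Plane := toCoord p z.proj z.snd

/-- The tangent vector with base point of coordinates `y` and components `X`, in the chart
around `p`. -/
def chartPoint (p : M) (y X : Plane) : TangentBundle (𝓡 2) M :=
  (trivializationAt Plane (TangentSpace (𝓡 2) : M → Type _) p).toOpenPartialHomeomorph.symm
    ((extChartAt (𝓡 2) p).symm y, X)

section Coordinates

variable {p : M}

theorem chartPoint_proj {y : Plane} (hy : y ∈ (extChartAt (𝓡 2) p).target) (X : Plane) :
    (chartPoint p y X).proj = (extChartAt (𝓡 2) p).symm y :=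
  (trivializationAt Plane (TangentSpace (𝓡 2) : M → Type _) p).proj_symm_apply'
    (extChartAt_symm_mem hy)

theorem chartPoint_proj_mem {y : Plane} (hy : y ∈ (extChartAt (𝓡 2) p).target) (X : Plane) :
    (chartPoint p y X).proj ∈ (chartAt Plane p).source := by
  rw [chartPoint_proj hy]; exact extChartAt_symm_mem hy

theorem chartPos_chartPoint {y : Plane} (hy : y ∈ (extChartAt (𝓡 2) p).target) (X : Plane) :
    chartPos p (chartPoint p y X) = y := by
  rw [chartPos, chartPoint_proj hy, (extChartAt (𝓡 2) p).right_inv hy]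

theorem chartVec_chartPoint {y : Plane} (hy : y ∈ (extChartAt (𝓡 2) p).target) (X : Plane) :
    chartVec p (chartPoint p y X) = X := by
  rw [chartVec, toCoord_apply (chartPoint_proj_mem hy X)]
  exact congrArg Prod.snd ((trivializationAt Plane (TangentSpace (𝓡 2) : M → Type _)
    p).apply_symm_apply' (b := (extChartAt (𝓡 2) p).symm y) (extChartAt_symm_mem hy) (x := X))

theorem chartPoint_chartPos_chartVec {z : TangentBundle (𝓡 2) M}
    (hz : z.proj ∈ (chartAt Plane p).source) : chartPoint p (chartPos p z) (chartVec p z) = z := by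
  have hs : z ∈ (trivializationAt Plane (TangentSpace (𝓡 2) : M → Type _) p).source :=
    (Trivialization.mem_source _).2 hz
  rw [chartPoint, chartPos, (extChartAt (𝓡 2) p).left_inv (by rwa [extChartAt_source]), chartVec,
    toCoord_apply hz]
  have h1 : (z.proj, (trivializationAt Plane (TangentSpace (𝓡 2) : M → Type _) p z).2) =
      trivializationAt Plane (TangentSpace (𝓡 2) : M → Type _) p z :=
    Trivialization.mk_proj_snd _ hs
  exact (congrArg _ h1).trans (OpenPartialHomeomorph.left_inv _ hs)

theorem contMDiffOn_chartPoint :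
    ContMDiffOn 𝓘(ℝ, Plane × Plane) (𝓡 2).tangent ∞ (fun z : Plane × Plane => chartPoint p z.1 z.2)
      ((extChartAt (𝓡 2) p).target ×ˢ univ) := by
  have h1 := Bundle.Trivialization.contMDiffOn_symm (IB := 𝓡 2) (n := ∞)
    (trivializationAt Plane (TangentSpace (𝓡 2) : M → Type _) p)
  refine h1.comp (t := (trivializationAt Plane (TangentSpace (𝓡 2) : M → Type _) p).target)
    (f := fun z : Plane × Plane => ((extChartAt (𝓡 2) p).symm z.1, z.2)) ?_ ?_
  · refine ContMDiffOn.prodMk ?_ contDiff_snd.contMDiff.contMDiffOn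
    exact (contMDiffOn_extChartAt_symm p).comp contDiff_fst.contMDiff.contMDiffOn fun z hz => hz.1
  · intro z hz
    rw [mem_preimage, Trivialization.mem_target]
    exact extChartAt_symm_mem hz.1

theorem contDiffWithinAt_chartPos {c : ℝ → TangentBundle (𝓡 2) M} {T : Set ℝ} {t : ℝ}
    (hc : ContMDiffWithinAt 𝓘(ℝ, ℝ) (𝓡 2).tangent ∞ c T t)
    (hp : (c t).proj ∈ (chartAt Plane p).source) :
    ContDiffWithinAt ℝ ∞ (fun τ => chartPos p (c τ)) T t := by
  have h1 := (Bundle.contMDiffWithinAt_totalSpace.1 hc).1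
  have h2 : ContMDiffAt (𝓡 2) 𝓘(ℝ, Plane) ∞ (extChartAt (𝓡 2) p) (c t).proj :=
    contMDiffAt_extChartAt' hp
  exact (h2.comp_contMDiffWithinAt t h1).contDiffWithinAt

theorem contDiffWithinAt_chartVec {c : ℝ → TangentBundle (𝓡 2) M} {T : Set ℝ} {t : ℝ} (ht : t ∈ T)
    (hc : ContMDiffWithinAt 𝓘(ℝ, ℝ) (𝓡 2).tangent ∞ c T t)
    (hp : (c t).proj ∈ (chartAt Plane p).source) :
    ContDiffWithinAt ℝ ∞ (fun τ => chartVec p (c τ)) T t := by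
  have hs : c t ∈ (trivializationAt Plane (TangentSpace (𝓡 2) : M → Type _) p).source :=
    (Trivialization.mem_source _).2 hp
  have h1 := (Bundle.contMDiffWithinAt_totalSpace.1 hc).1
  have h2 := ((Bundle.Trivialization.contMDiffWithinAt_iff hs).1 hc).2.contDiffWithinAt
  have hev : ∀ᶠ τ in 𝓝[T] t, (c τ).proj ∈ (chartAt Plane p).source :=
    h1.continuousWithinAt.eventually_mem ((chartAt Plane p).open_source.mem_nhds hp)
  exact h2.congr_of_eventuallyEq_of_mem (hev.mono fun τ hτ => toCoord_apply hτ _) ht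

theorem mdifferentiableWithinAt_baseCurve {c : ℝ → TangentBundle (𝓡 2) M} {T : Set ℝ} {t : ℝ}
    (hc : ContMDiffWithinAt 𝓘(ℝ, ℝ) (𝓡 2).tangent ∞ c T t) :
    MDifferentiableWithinAt 𝓘(ℝ, ℝ) (𝓡 2) (baseCurve c) T t :=
  (Bundle.contMDiffWithinAt_totalSpace.1 hc).1.mdifferentiableWithinAt (by simp)

theorem velocity_eq {c : ℝ → TangentBundle (𝓡 2) M} {T : Set ℝ} {t : ℝ}
    (hT : UniqueDiffWithinAt ℝ T t)
    (hc : ContMDiffWithinAt 𝓘(ℝ, ℝ) (𝓡 2).tangent ∞ c T t)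
    (hp : (c t).proj ∈ (chartAt Plane p).source) :
    velocity T (baseCurve c) t =
      ofCoord p (c t).proj (derivWithin (fun τ => chartPos p (c τ)) T t) := by
  rw [← ofCoord_toCoord (p := p) (x := baseCurve c t) hp (velocity T (baseCurve c) t),
    toCoord_velocity hT (mdifferentiableWithinAt_baseCurve hc) hp]
  rfl

end Coordinates

variable [RiemannianBundle (fun x : M => TangentSpace (𝓡 2) x)]

theorem norm_ofCoord_sq {p x : M} (hx : x ∈ (chartAt Plane p).source) (X : Plane) :
    ‖ofCoord p x X‖ ^ 2 = metricForm p (extChartAt (𝓡 2) p x) X X := by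
  rw [metricForm_extChartAt hx, real_inner_self_eq_norm_sq]

theorem norm_snd_sq {p : M} {z : TangentBundle (𝓡 2) M}
    (hz : z.proj ∈ (chartAt Plane p).source) :
    ‖z.snd‖ ^ 2 = metricForm p (chartPos p z) (chartVec p z) (chartVec p z) := by
  rw [chartPos, ← norm_ofCoord_sq hz, chartVec, ofCoord_toCoord hz]

/-- The connection form of the frame, in the chart around `p`. -/
abbrev chartConnForm (σ : ℝ) (p : M) : Plane → Plane →L[ℝ] ℝ :=
  connForm (metricForm p) (connection p) (frameFst p) (frameSnd σ p)

variable [IsContMDiffRiemannianBundle (𝓡 2) ∞ Plane (fun x : M => TangentSpace (𝓡 2) x)]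
  {c : ℝ → TangentBundle (𝓡 2) M} {T : Set ℝ} {t : ℝ} {p : M} {σ : ℝ}

theorem covDeriv_pointer_eq (hT : UniqueDiffWithinAt ℝ T t) (ht : t ∈ T)
    (hc : ContMDiffWithinAt 𝓘(ℝ, ℝ) (𝓡 2).tangent ∞ c T t)
    (hp : (c t).proj ∈ (chartAt Plane p).source) :
    covDeriv T (baseCurve c) (pointer c) t = ofCoord p (c t).proj
      (derivWithin (fun τ => chartVec p (c τ)) T t + connection p (chartPos p (c t))
        (derivWithin (fun τ => chartPos p (c τ)) T t) (chartVec p (c t))) :=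
  covDeriv_eq hT (mdifferentiableWithinAt_baseCurve hc) hp
    ((contDiffWithinAt_chartVec ht hc hp).differentiableWithinAt (by simp))

theorem energy_eq {m Ia : ℝ} (hT : UniqueDiffWithinAt ℝ T t) (ht : t ∈ T)
    (hc : ContMDiffWithinAt 𝓘(ℝ, ℝ) (𝓡 2).tangent ∞ c T t)
    (hp : (c t).proj ∈ (chartAt Plane p).source) :
    energy m Ia T c t =
      1 / 2 * m * metricForm p (chartPos p (c t)) (derivWithin (fun τ => chartPos p (c τ)) T t)
        (derivWithin (fun τ => chartPos p (c τ)) T t)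
      + 1 / 2 * Ia * metricForm p (chartPos p (c t))
        (derivWithin (fun τ => chartVec p (c τ)) T t + connection p (chartPos p (c t))
          (derivWithin (fun τ => chartPos p (c τ)) T t) (chartVec p (c t)))
        (derivWithin (fun τ => chartVec p (c τ)) T t + connection p (chartPos p (c t))
          (derivWithin (fun τ => chartPos p (c τ)) T t) (chartVec p (c t))) := by
  have hp' : baseCurve c t ∈ (chartAt Plane p).source := hp
  rw [energy, velocity_eq hT hc hp, covDeriv_pointer_eq hT ht hc hp]
  erw [norm_ofCoord_sq hp', norm_ofCoord_sq hp']
  rfl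

/-- The energy at time `t` depends only on the motion near `t`. -/
theorem energy_congr {m Ia : ℝ} {c' : ℝ → TangentBundle (𝓡 2) M} (hT : UniqueDiffWithinAt ℝ T t)
    (ht : t ∈ T) (hc : ContMDiffWithinAt 𝓘(ℝ, ℝ) (𝓡 2).tangent ∞ c T t)
    (h : c' =ᶠ[𝓝[T] t] c) : energy m Ia T c' t = energy m Ia T c t := by
  have h0 : c' t = c t := h.self_of_nhdsWithin ht
  have hc' : ContMDiffWithinAt 𝓘(ℝ, ℝ) (𝓡 2).tangent ∞ c' T t := hc.congr_of_eventuallyEq h h0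
  have hp : (c t).proj ∈ (chartAt Plane (c t).proj).source := mem_chart_source _ _
  have h1 : (fun τ => chartPos (c t).proj (c' τ)) =ᶠ[𝓝[T] t] fun τ => chartPos (c t).proj (c τ) :=
    h.mono fun τ hτ => congrArg (chartPos _) hτ
  have h2 : (fun τ => chartVec (c t).proj (c' τ)) =ᶠ[𝓝[T] t] fun τ => chartVec (c t).proj (c τ) :=
    h.mono fun τ hτ => congrArg (chartVec _) hτ
  rw [energy_eq (p := (c t).proj) hT ht hc' (by rw [h0]; exact hp), energy_eq hT ht hc hp,
    h1.derivWithin_eq_of_mem ht, h2.derivWithin_eq_of_mem ht, h0]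

/-- In terms of the components `α, β` of the pointer in the frame, its covariant derivative is the
axial angular velocity times the rotated pointer. -/
theorem derivWithin_add_connection {q X : ℝ → Plane} {α β : ℝ → ℝ} {q' : Plane} {α' β' : ℝ}
    (hσ : σ ^ 2 = 1) (hT : UniqueDiffWithinAt ℝ T t) (ht : t ∈ T)
    (hU : q t ∈ (extChartAt (𝓡 2) p).target) (hq : HasDerivWithinAt q q' T t)
    (hα : HasDerivWithinAt α α' T t) (hβ : HasDerivWithinAt β β' T t)
    (hunit : ∀ᶠ τ in 𝓝[T] t, α τ ^ 2 + β τ ^ 2 = 1)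
    (hX : ∀ᶠ τ in 𝓝[T] t, X τ = α τ • frameFst p (q τ) + β τ • frameSnd σ p (q τ)) :
    derivWithin X T t + connection p (q t) q' (X t) =
      (α t * β' - β t * α' + chartConnForm σ p (q t) q') •
        (α t • frameSnd σ p (q t) - β t • frameFst p (q t)) := by
  have h1 := (isFramedMetric p hσ).hasDerivWithinAt_frame hq hU hα hβ
  have hX' := h1.congr_of_eventuallyEq hX (hX.self_of_nhdsWithin ht)
  have hu := hunit.self_of_nhdsWithin ht
  have h2 : HasDerivWithinAt (fun τ => α τ ^ 2 + β τ ^ 2) 0 T t :=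
    (hasDerivWithinAt_const t T (1 : ℝ)).congr_of_eventuallyEq hunit hu
  have h3 := (hT.eq_deriv _ h2 ((hα.pow 2).add (hβ.pow 2)))
  simp only [Nat.cast_ofNat, Nat.add_one_sub_one, pow_one] at h3
  have e1 : α' = -(β t * (α t * β' - β t * α')) := by
    linear_combination (-(1 / 2) * α t) * h3 - α' * hu
  have e2 : β' = α t * (α t * β' - β t * α') := by
    linear_combination (-(1 / 2) * β t) * h3 - β' * hu
  rw [hX'.derivWithin hT, hX.self_of_nhdsWithin ht]
  set ρ := α t * β' - β t * α'
  rw [e1, e2]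
  module

theorem metricForm_rotated {y : Plane} (hσ : σ ^ 2 = 1) (hy : y ∈ (extChartAt (𝓡 2) p).target)
    (w α β : ℝ) (hu : α ^ 2 + β ^ 2 = 1) :
    metricForm p y (w • (α • frameSnd σ p y - β • frameFst p y))
      (w • (α • frameSnd σ p y - β • frameFst p y)) = w ^ 2 := by
  have h := isFramedMetric p hσ
  simp only [map_smul, map_sub, smul_apply, sub_apply, smul_eq_mul, h.fst_fst y hy,
    h.snd_snd y hy, h.fst_snd y hy, h.symm y hy (frameSnd σ p y) (frameFst p y)]
  linear_combination w ^ 2 * hu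

theorem metricForm_frame {y : Plane} (hσ : σ ^ 2 = 1) (hy : y ∈ (extChartAt (𝓡 2) p).target)
    (α β : ℝ) :
    metricForm p y (α • frameFst p y + β • frameSnd σ p y)
      (α • frameFst p y + β • frameSnd σ p y) = α ^ 2 + β ^ 2 := by
  have h := isFramedMetric p hσ
  simp only [map_smul, map_add, smul_apply, add_apply, smul_eq_mul, h.fst_fst y hy,
    h.snd_snd y hy, h.fst_snd y hy, h.symm y hy (frameSnd σ p y) (frameFst p y)]
  ring

/-- The energy of a motion is the local Lagrangian. -/
theorem energy_eq_lagrangian {m Ia : ℝ} {q : ℝ → Plane} {α β : ℝ → ℝ} {q' : Plane} {α' β' : ℝ}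
    (hσ : σ ^ 2 = 1) (hT : UniqueDiffWithinAt ℝ T t) (ht : t ∈ T)
    (hc : ContMDiffWithinAt 𝓘(ℝ, ℝ) (𝓡 2).tangent ∞ c T t)
    (hp : (c t).proj ∈ (chartAt Plane p).source)
    (hcq : ∀ᶠ τ in 𝓝[T] t, chartPos p (c τ) = q τ) (hq : HasDerivWithinAt q q' T t)
    (hα : HasDerivWithinAt α α' T t) (hβ : HasDerivWithinAt β β' T t)
    (hunit : ∀ᶠ τ in 𝓝[T] t, α τ ^ 2 + β τ ^ 2 = 1)
    (hX : ∀ᶠ τ in 𝓝[T] t,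
      chartVec p (c τ) = α τ • frameFst p (q τ) + β τ • frameSnd σ p (q τ)) :
    energy m Ia T c t = lagrangian m Ia (metricForm p) (chartConnForm σ p) (q t) q'
      (α t * β' - β t * α') := by
  have hq0 := hcq.self_of_nhdsWithin ht
  have hU : q t ∈ (extChartAt (𝓡 2) p).target := hq0 ▸ chartPos_mem hp
  have hq' : derivWithin (fun τ => chartPos p (c τ)) T t = q' :=
    (hq.congr_of_eventuallyEq hcq hq0).derivWithin hT
  rw [energy_eq hT ht hc hp, hq', hq0,
    derivWithin_add_connection hσ hT ht hU hq hα hβ hunit hX,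
    metricForm_rotated hσ hU _ _ _ (hunit.self_of_nhdsWithin ht), lagrangian]

theorem continuousOn_energy {m Ia a b : ℝ} (hab : a < b) (hc : IsUnitCurve a b c) :
    ContinuousOn (energy m Ia (Icc a b) c) (Icc a b) := by
  intro t₀ ht₀
  have hT : UniqueDiffOn ℝ (Icc a b) := uniqueDiffOn_Icc hab
  have hb := (Bundle.contMDiffWithinAt_totalSpace.1 (hc.1 t₀ ht₀)).1.continuousWithinAt
  set p := (c t₀).proj
  have hev : ∀ᶠ τ in 𝓝[Icc a b] t₀, (c τ).proj ∈ (chartAt Plane p).source :=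
    hb.eventually_mem ((chartAt Plane p).open_source.mem_nhds (mem_chart_source _ _))
  obtain ⟨V, hV, htV, hVs⟩ := mem_nhdsWithin.1 hev
  rw [inter_comm] at hVs
  have hq : ContDiffOn ℝ ∞ (fun τ => chartPos p (c τ)) (Icc a b ∩ V) := fun t ht =>
    (contDiffWithinAt_chartPos (hc.1 t ht.1) (hVs ht)).mono inter_subset_left
  have hX : ContDiffOn ℝ ∞ (fun τ => chartVec p (c τ)) (Icc a b ∩ V) := fun t ht =>
    (contDiffWithinAt_chartVec ht.1 (hc.1 t ht.1) (hVs ht)).mono inter_subset_left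
  have hq' := contDiffOn_derivWithin_inter hT hV hq
  have hX' := contDiffOn_derivWithin_inter hT hV hX
  have hmaps : MapsTo (fun τ => chartPos p (c τ)) (Icc a b ∩ V) (extChartAt (𝓡 2) p).target :=
    fun t ht => chartPos_mem (hVs ht)
  have hg := (contDiffOn_metricForm p).comp hq hmaps
  have hΓ := (contDiffOn_connection p).comp hq hmaps
  have hD := hX'.add ((hΓ.clm_apply hq').clm_apply hX)
  have hE := ((contDiffOn_const (c := 1 / 2 * m)).mul ((hg.clm_apply hq').clm_apply hq')).add
    ((contDiffOn_const (c := 1 / 2 * Ia)).mul ((hg.clm_apply hD).clm_apply hD))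
  have hcont : ContinuousWithinAt (energy m Ia (Icc a b) c) (Icc a b ∩ V) t₀ :=
    (hE.continuousOn.congr fun t ht =>
      energy_eq (hT t ht.1) ht.1 (hc.1 t ht.1) (hVs ht)) t₀ ⟨ht₀, htV⟩
  exact (continuousWithinAt_inter (hV.mem_nhds htV)).1 hcont

end Motion

/-! ### Variations supported in a chart -/

section Variation

open Set Filter Topology

variable {M : Type*} [TopologicalSpace M] [ChartedSpace Plane M] [IsManifold (𝓡 2) ∞ M]
  [RiemannianBundle (fun x : M => TangentSpace (𝓡 2) x)]

/-- First component of a tangent vector in the frame of the chart around `p`. -/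
def pointerFst (p : M) (z : TangentBundle (𝓡 2) M) : ℝ :=
  metricForm p (chartPos p z) (chartVec p z) (frameFst p (chartPos p z))

/-- Second component of a tangent vector in the frame of the chart around `p`. -/
def pointerSnd (σ : ℝ) (p : M) (z : TangentBundle (𝓡 2) M) : ℝ :=
  metricForm p (chartPos p z) (chartVec p z) (frameSnd σ p (chartPos p z))

/-- The vector at the point of coordinates `y` with components `α`, `β` in the frame of the chart
around `p`. -/
def framePoint (σ : ℝ) (p : M) (y : Plane) (α β : ℝ) : TangentBundle (𝓡 2) M :=
  chartPoint p y (α • frameFst p y + β • frameSnd σ p y)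

open Classical in
/-- The variation of the motion `c` on the time set `I`: the position is translated in coordinates
by `s f v`, and the components of the pointer in the frame are rotated by the angle `s κ f`. -/
def variedCurve (σ : ℝ) (p : M) (c : ℝ → TangentBundle (𝓡 2) M) (I : Set ℝ) (f : ℝ → ℝ) (v : Plane)
    (κ s t : ℝ) : TangentBundle (𝓡 2) M :=
  if t ∈ I then
    framePoint σ p (chartPos p (c t) + s • (f t • v))
      (Real.cos (s * (κ * f t)) * pointerFst p (c t) - Real.sin (s * (κ * f t)) * pointerSnd σ p (c t))
      (Real.sin (s * (κ * f t)) * pointerFst p (c t) + Real.cos (s * (κ * f t)) * pointerSnd σ p (c t))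
  else c t

variable [IsContMDiffRiemannianBundle (𝓡 2) ∞ Plane (fun x : M => TangentSpace (𝓡 2) x)]
  {c : ℝ → TangentBundle (𝓡 2) M} {p : M} {σ : ℝ}

theorem chartVec_eq (hσ : σ ^ 2 = 1) {z : TangentBundle (𝓡 2) M}
    (hz : z.proj ∈ (chartAt Plane p).source) :
    chartVec p z = pointerFst p z • frameFst p (chartPos p z)
      + pointerSnd σ p z • frameSnd σ p (chartPos p z) :=
  ((isFramedMetric p hσ).expand _ (chartPos_mem hz) _).symm

theorem pointerFst_sq_add_pointerSnd_sq (hσ : σ ^ 2 = 1) {z : TangentBundle (𝓡 2) M}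
    (hz : z.proj ∈ (chartAt Plane p).source) (hu : ‖z.snd‖ = 1) :
    pointerFst p z ^ 2 + pointerSnd σ p z ^ 2 = 1 := by
  have h := norm_snd_sq hz
  rw [hu, chartVec_eq hσ hz, metricForm_frame hσ (chartPos_mem hz)] at h
  rw [← h]; norm_num

theorem framePoint_pointer (hσ : σ ^ 2 = 1) {z : TangentBundle (𝓡 2) M}
    (hz : z.proj ∈ (chartAt Plane p).source) :
    framePoint σ p (chartPos p z) (pointerFst p z) (pointerSnd σ p z) = z := by
  rw [framePoint, ← chartVec_eq hσ hz, chartPoint_chartPos_chartVec hz]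

theorem norm_framePoint (hσ : σ ^ 2 = 1) {y : Plane} (hy : y ∈ (extChartAt (𝓡 2) p).target)
    {α β : ℝ} (hu : α ^ 2 + β ^ 2 = 1) : ‖(framePoint σ p y α β).snd‖ = 1 := by
  have h := norm_snd_sq (p := p) (z := framePoint σ p y α β) (chartPoint_proj_mem hy _)
  rw [framePoint, chartPos_chartPoint hy, chartVec_chartPoint hy, metricForm_frame hσ hy, hu] at h
  exact (pow_eq_one_iff_of_nonneg (norm_nonneg _) two_ne_zero).1 h

theorem variedCurve_of_eq_zero (hσ : σ ^ 2 = 1) {I : Set ℝ} {f : ℝ → ℝ} {v : Plane} {κ s t : ℝ}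
    (hI : t ∈ I → (c t).proj ∈ (chartAt Plane p).source) (h : s * f t = 0) :
    variedCurve σ p c I f v κ s t = c t := by
  rw [variedCurve]
  split_ifs with ht
  · have h' : s * (κ * f t) = 0 := by linear_combination κ * h
    rw [smul_smul, h, h', zero_smul, add_zero, Real.cos_zero, Real.sin_zero]
    simp only [one_mul, zero_mul, sub_zero, zero_add]
    exact framePoint_pointer hσ (hI ht)
  · rfl

/-- A translate of the position by a small multiple of a compactly supported field stays in the
domain of the coordinates. -/
theorem exists_forall_add_smul_mem {U : Set Plane} (hU : IsOpen U) {q : ℝ → Plane} {f : ℝ → ℝ}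
    {I : Set ℝ} {c d : ℝ} (hq : ContinuousOn q (Icc c d)) (hqU : ∀ t ∈ I, q t ∈ U)
    (hI : Icc c d ⊆ I) (hf : Continuous f) (hfs : tsupport f ⊆ Icc c d) (v : Plane) :
    ∃ ε : ℝ, 0 < ε ∧ ∀ s ∈ Ioo (-ε) ε, ∀ t ∈ I, q t + s • (f t • v) ∈ U := by
  obtain ⟨δ, hδ, hsub⟩ := (isCompact_Icc.image_of_continuousOn hq).exists_thickening_subset_open hU
    (image_subset_iff.2 fun t ht => hqU t (hI ht))
  obtain ⟨B, hB⟩ := (isCompact_Icc (a := c) (b := d)).exists_bound_of_continuousOn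
    (f := fun t => f t • v) (hf.smul continuous_const).continuousOn
  have hB1 : 0 < |B| + 1 := by positivity
  refine ⟨δ / (|B| + 1), by positivity, fun s hs t ht => ?_⟩
  by_cases htI : t ∈ Icc c d
  · refine hsub (Metric.mem_thickening_iff.2 ⟨q t, mem_image_of_mem _ htI, ?_⟩)
    rw [dist_self_add_left, norm_smul, Real.norm_eq_abs]
    have h1 : |s| < δ / (|B| + 1) := abs_lt.2 hs
    have h2 : ‖f t • v‖ ≤ |B| + 1 := (hB t htI).trans (by linarith [le_abs_self B])
    calc |s| * ‖f t • v‖ ≤ |s| * (|B| + 1) := by gcongr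
      _ < δ / (|B| + 1) * (|B| + 1) := by gcongr
      _ = δ := by field_simp
  · have : f t = 0 := image_eq_zero_of_notMem_tsupport fun h => htI (hfs h)
    rw [this, zero_smul, smul_zero, add_zero]
    exact hqU t ht

theorem contDiffOn_pointer {a b : ℝ} {I : Set ℝ} (hσ : σ ^ 2 = 1) (hIab : I ⊆ Icc a b)
    (hc : IsUnitCurve a b c) (hI : ∀ t ∈ I, (c t).proj ∈ (chartAt Plane p).source) :
    ContDiffOn ℝ ∞ (fun t => chartPos p (c t)) I ∧ ContDiffOn ℝ ∞ (fun t => chartVec p (c t)) I ∧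
      ContDiffOn ℝ ∞ (fun t => pointerFst p (c t)) I ∧
      ContDiffOn ℝ ∞ (fun t => pointerSnd σ p (c t)) I := by
  have h := isFramedMetric p hσ
  have hq : ContDiffOn ℝ ∞ (fun τ => chartPos p (c τ)) I := fun t ht =>
    (contDiffWithinAt_chartPos (hc.1 t (hIab ht)) (hI t ht)).mono hIab
  have hX : ContDiffOn ℝ ∞ (fun τ => chartVec p (c τ)) I := fun t ht =>
    (contDiffWithinAt_chartVec (hIab ht) (hc.1 t (hIab ht)) (hI t ht)).mono hIab
  have hmaps : MapsTo (fun τ => chartPos p (c τ)) I (extChartAt (𝓡 2) p).target :=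
    fun t ht => chartPos_mem (hI t ht)
  have hg := (contDiffOn_metricForm p).comp hq hmaps
  exact ⟨hq, hX, (hg.clm_apply hX).clm_apply (h.contDiffOn_fst.comp hq hmaps),
    (hg.clm_apply hX).clm_apply (h.contDiffOn_snd.comp hq hmaps)⟩

/-- Outside the support of `f` the varied curves agree with `c`, which gives smoothness up to the
endpoints of `[a, b]`. -/
theorem isVariation_variedCurve {a b a' b' ε κ : ℝ} {f : ℝ → ℝ} {v : Plane} (hσ : σ ^ 2 = 1)
    (haa : a ≤ a') (hbb : b' ≤ b) (hc : IsUnitCurve a b c)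
    (hI : ∀ t ∈ Ioo a' b', (c t).proj ∈ (chartAt Plane p).source) (hf : ContDiff ℝ ∞ f)
    (hfs : tsupport f ⊆ Ioo a' b') (hε : 0 < ε)
    (hmem : ∀ s ∈ Ioo (-ε) ε, ∀ t ∈ Ioo a' b',
      chartPos p (c t) + s • (f t • v) ∈ (extChartAt (𝓡 2) p).target) :
    IsVariation a b c ε (variedCurve σ p c (Ioo a' b') f v κ) := by
  have hIab : Ioo a' b' ⊆ Icc a b := fun t ht => ⟨haa.trans ht.1.le, ht.2.le.trans hbb⟩
  have h := isFramedMetric p hσ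
  obtain ⟨hq, -, hα, hβ⟩ := contDiffOn_pointer hσ hIab hc hI
  have hfix : ∀ s t, t ∉ Ioo a' b' → variedCurve σ p c (Ioo a' b') f v κ s t = c t :=
    fun s t ht => if_neg ht
  refine ⟨hε, ?_, ?_, fun t _ => variedCurve_of_eq_zero hσ (hI t) (by ring),
    fun s _ => hfix s a fun h' => h'.1.not_ge haa, fun s _ => hfix s b fun h' => h'.2.not_ge hbb⟩
  · rintro ⟨s, t⟩ ⟨hs, ht⟩
    by_cases htI : t ∈ Ioo a' b'
    · have hopen : IsOpen (Ioo (-ε) ε ×ˢ Ioo a' b') := isOpen_Ioo.prod isOpen_Ioo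
      have hsnd : MapsTo (Prod.snd : ℝ × ℝ → ℝ) (Ioo (-ε) ε ×ˢ Ioo a' b') (Ioo a' b') :=
        fun z hz => hz.2
      have hfst : ContDiffOn ℝ ∞ (Prod.fst : ℝ × ℝ → ℝ) (Ioo (-ε) ε ×ˢ Ioo a' b') :=
        contDiff_fst.contDiffOn
      have hq2 := hq.comp contDiff_snd.contDiffOn hsnd
      have hα2 := hα.comp contDiff_snd.contDiffOn hsnd
      have hβ2 := hβ.comp contDiff_snd.contDiffOn hsnd
      have hf2 : ContDiffOn ℝ ∞ (fun z : ℝ × ℝ => f z.2) (Ioo (-ε) ε ×ˢ Ioo a' b') :=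
        (hf.comp contDiff_snd).contDiffOn
      have hpos : ContDiffOn ℝ ∞ (fun z : ℝ × ℝ => chartPos p (c z.2) + z.1 • (f z.2 • v))
          (Ioo (-ε) ε ×ˢ Ioo a' b') := hq2.add (hfst.smul (hf2.smul contDiffOn_const))
      have hmaps : MapsTo (fun z : ℝ × ℝ => chartPos p (c z.2) + z.1 • (f z.2 • v))
          (Ioo (-ε) ε ×ˢ Ioo a' b') (extChartAt (𝓡 2) p).target :=
        fun z hz => hmem z.1 hz.1 z.2 hz.2
      have hangle : ContDiffOn ℝ ∞ (fun z : ℝ × ℝ => z.1 * (κ * f z.2))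
          (Ioo (-ε) ε ×ˢ Ioo a' b') := hfst.mul (contDiffOn_const.mul hf2)
      have hcos := Real.contDiff_cos.comp_contDiffOn hangle
      have hsin := Real.contDiff_sin.comp_contDiffOn hangle
      have hvec := (((hcos.mul hα2).sub (hsin.mul hβ2)).smul (h.contDiffOn_fst.comp hpos hmaps)).add
        (((hsin.mul hα2).add (hcos.mul hβ2)).smul (h.contDiffOn_snd.comp hpos hmaps))
      have hC := (contMDiffOn_chartPoint (p := p)).comp (hpos.prodMk hvec).contMDiffOn
        fun z hz => ⟨hmaps hz, mem_univ _⟩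
      have hC' := hC.contMDiffAt (hopen.mem_nhds (⟨hs, htI⟩ : (s, t) ∈ Ioo (-ε) ε ×ˢ Ioo a' b'))
      refine ContMDiffAt.contMDiffWithinAt (hC'.congr_of_eventuallyEq ?_)
      filter_upwards [hopen.mem_nhds (⟨hs, htI⟩ : (s, t) ∈ Ioo (-ε) ε ×ˢ Ioo a' b')] with z hz
      exact if_pos hz.2
    · have h1 : ContMDiffWithinAt 𝓘(ℝ, ℝ × ℝ) (𝓡 2).tangent ∞ (fun z : ℝ × ℝ => c z.2)
          (Ioo (-ε) ε ×ˢ Icc a b) (s, t) :=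
        ContMDiffWithinAt.comp (t := Icc a b) (g := c) (f := Prod.snd) (s, t) (hc.1 t ht)
          (contDiff_snd.contMDiff _).contMDiffWithinAt fun z hz => hz.2
      refine h1.congr_of_eventuallyEq (Filter.Eventually.filter_mono nhdsWithin_le_nhds ?_)
        (hfix s t htI)
      have ht' : t ∈ (tsupport f)ᶜ := fun h' => htI (hfs h')
      filter_upwards [((isClosed_tsupport f).isOpen_compl.preimage continuous_snd).mem_nhds
        (show (s, t) ∈ Prod.snd ⁻¹' (tsupport f)ᶜ from ht')] with z hz
      exact variedCurve_of_eq_zero hσ (hI z.2)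
        (by rw [image_eq_zero_of_notMem_tsupport hz, mul_zero])
  · intro s hs t ht
    by_cases htI : t ∈ Ioo a' b'
    · have hu := pointerFst_sq_add_pointerSnd_sq hσ (hI t htI) (hc.2 t ht)
      change ‖(variedCurve σ p c (Ioo a' b') f v κ s t).snd‖ = 1
      rw [variedCurve, if_pos htI]
      refine norm_framePoint hσ (hmem s hs t htI) ?_
      linear_combination hu + (pointerFst p (c t) ^ 2 + pointerSnd σ p (c t) ^ 2) *
        Real.sin_sq_add_cos_sq (s * (κ * f t))
    · change ‖(variedCurve σ p c (Ioo a' b') f v κ s t).snd‖ = 1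
      rw [hfix s t htI]
      exact hc.2 t ht

/-- The rate of rotation of the pointer relative to the frame of the chart around `p`. -/
def pointerRate (σ : ℝ) (p : M) (T : Set ℝ) (c : ℝ → TangentBundle (𝓡 2) M) (t : ℝ) : ℝ :=
  pointerFst p (c t) * derivWithin (fun τ => pointerSnd σ p (c τ)) T t
    - pointerSnd σ p (c t) * derivWithin (fun τ => pointerFst p (c τ)) T t

/-- Rotating the pointer in the frame by the angle `s κ f` adds `s κ f'` to its rate of rotation. -/
theorem energy_variedCurve {m Ia a b a' b' ε κ s t : ℝ} {f : ℝ → ℝ} {v : Plane} (hσ : σ ^ 2 = 1)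
    (hab : a < b) (haa : a ≤ a') (hbb : b' ≤ b) (hc : IsUnitCurve a b c)
    (hI : ∀ t ∈ Ioo a' b', (c t).proj ∈ (chartAt Plane p).source) (hf : ContDiff ℝ ∞ f)
    (hmem : ∀ s ∈ Ioo (-ε) ε, ∀ t ∈ Ioo a' b',
      chartPos p (c t) + s • (f t • v) ∈ (extChartAt (𝓡 2) p).target)
    (hC : IsVariation a b c ε (variedCurve σ p c (Ioo a' b') f v κ))
    (hs : s ∈ Ioo (-ε) ε) (ht : t ∈ Ioo a' b') :
    energy m Ia (Icc a b) (variedCurve σ p c (Ioo a' b') f v κ s) t =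
      lagrangian m Ia (metricForm p) (chartConnForm σ p) (chartPos p (c t) + s • (f t • v))
        (deriv (fun τ => chartPos p (c τ)) t + s • (deriv f t • v))
        (pointerRate σ p univ c t + s * (κ * deriv f t)) := by
  have hIab : Ioo a' b' ⊆ Icc a b := fun t ht => ⟨haa.trans ht.1.le, ht.2.le.trans hbb⟩
  have hnhds := isOpen_Ioo.mem_nhds ht
  obtain ⟨hq, -, hα, hβ⟩ := contDiffOn_pointer hσ hIab hc hI
  have dq := ((hq.differentiableOn (by simp)).differentiableAt hnhds).hasDerivAt
  have dα := ((hα.differentiableOn (by simp)).differentiableAt hnhds).hasDerivAt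
  have dβ := ((hβ.differentiableOn (by simp)).differentiableAt hnhds).hasDerivAt
  have df : HasDerivAt f (deriv f t) t := (hf.differentiable (by simp) t).hasDerivAt
  have dθ : HasDerivAt (fun τ => s * (κ * f τ)) (s * (κ * deriv f t)) t :=
    (df.const_mul κ).const_mul s
  have dq2 : HasDerivAt (fun τ => chartPos p (c τ) + s • (f τ • v))
      (deriv (fun τ => chartPos p (c τ)) t + s • (deriv f t • v)) t :=
    dq.add ((df.smul_const v).const_smul s)
  have dα2 := (dθ.cos.mul dα).sub (dθ.sin.mul dβ)
  have dβ2 := (dθ.sin.mul dα).add (dθ.cos.mul dβ)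
  have hev : ∀ᶠ τ in 𝓝[Icc a b] t, τ ∈ Ioo a' b' := nhdsWithin_le_nhds hnhds
  have hval : ∀ τ ∈ Ioo a' b', variedCurve σ p c (Ioo a' b') f v κ s τ =
      framePoint σ p (chartPos p (c τ) + s • (f τ • v))
        (Real.cos (s * (κ * f τ)) * pointerFst p (c τ)
          - Real.sin (s * (κ * f τ)) * pointerSnd σ p (c τ))
        (Real.sin (s * (κ * f τ)) * pointerFst p (c τ)
          + Real.cos (s * (κ * f τ)) * pointerSnd σ p (c τ)) := fun τ hτ => if_pos hτ
  have hsmooth : ContMDiffWithinAt 𝓘(ℝ, ℝ) (𝓡 2).tangent ∞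
      (variedCurve σ p c (Ioo a' b') f v κ s) (Icc a b) t := by
    have h1 : ContMDiffWithinAt 𝓘(ℝ, ℝ) 𝓘(ℝ, ℝ × ℝ) ∞ (fun τ : ℝ => (s, τ)) (Icc a b) t :=
      ((contDiff_const.prodMk contDiff_id).contMDiff _).contMDiffWithinAt
    exact ContMDiffWithinAt.comp (g := fun z : ℝ × ℝ =>
      variedCurve σ p c (Ioo a' b') f v κ z.1 z.2) t (hC.smooth (s, t) ⟨hs, hIab ht⟩) h1
      fun τ hτ => ⟨hs, hτ⟩
  have hE := energy_eq_lagrangian (m := m) (Ia := Ia) hσ (uniqueDiffOn_Icc hab t (hIab ht))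
    (hIab ht) hsmooth
    (p := p) (by rw [hval t ht]; exact chartPoint_proj_mem (hmem s hs t ht) _)
    (hev.mono fun τ hτ => by rw [hval τ hτ, framePoint, chartPos_chartPoint (hmem s hs τ hτ)])
    dq2.hasDerivWithinAt dα2.hasDerivWithinAt dβ2.hasDerivWithinAt
    (hev.mono fun τ hτ => by
      have hu := pointerFst_sq_add_pointerSnd_sq hσ (hI τ hτ) (hc.2 τ (hIab hτ))
      simp only [Pi.add_apply, Pi.sub_apply, Pi.mul_apply]
      linear_combination hu + (pointerFst p (c τ) ^ 2 + pointerSnd σ p (c τ) ^ 2) *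
        Real.sin_sq_add_cos_sq (s * (κ * f τ)))
    (hev.mono fun τ hτ => by
      rw [hval τ hτ, framePoint, chartVec_chartPoint (hmem s hs τ hτ)]; rfl)
  rw [hE]
  congr 1
  simp only [Pi.add_apply, Pi.sub_apply, Pi.mul_apply, pointerRate, derivWithin_univ]
  have hu := pointerFst_sq_add_pointerSnd_sq hσ (hI t ht) (hc.2 t (hIab ht))
  have hcs := Real.sin_sq_add_cos_sq (s * (κ * f t))
  linear_combination (pointerFst p (c t) * deriv (fun τ => pointerSnd σ p (c τ)) t
    - pointerSnd σ p (c t) * deriv (fun τ => pointerFst p (c τ)) t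
    + s * (κ * deriv f t) * (pointerFst p (c t) ^ 2 + pointerSnd σ p (c t) ^ 2)) * hcs
    + s * (κ * deriv f t) * hu

theorem contDiffOn_pointerRate_univ {a b : ℝ} {a' b' : ℝ} (hσ : σ ^ 2 = 1)
    (hIab : Ioo a' b' ⊆ Icc a b) (hc : IsUnitCurve a b c)
    (hI : ∀ t ∈ Ioo a' b', (c t).proj ∈ (chartAt Plane p).source) :
    ContDiffOn ℝ ∞ (pointerRate σ p univ c) (Ioo a' b') := by
  obtain ⟨-, -, hα, hβ⟩ := contDiffOn_pointer hσ hIab hc hI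
  have hα' := hα.deriv_of_isOpen (m := ∞) isOpen_Ioo (by simp)
  have hβ' := hβ.deriv_of_isOpen (m := ∞) isOpen_Ioo (by simp)
  refine ((hα.mul hβ').sub (hβ.mul hα')).congr fun t _ => ?_
  rw [pointerRate, derivWithin_univ, derivWithin_univ]

/-- The first variation in coordinates vanishes for a critical motion. -/
theorem IsCritical.integral_deriv_lagrangian {m Ia a b a' b' : ℝ} (hσ : σ ^ 2 = 1) (hab : a < b)
    (haa : a ≤ a') (hbb : b' ≤ b) (hcrit : IsCritical m Ia a b c)
    (hI : ∀ t ∈ Ioo a' b', (c t).proj ∈ (chartAt Plane p).source)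
    (v : Plane) (κ : ℝ) {f : ℝ → ℝ} (hf : ContDiff ℝ ∞ f) {l r : ℝ} (hl : a' < l) (hlr : l < r)
    (hr : r < b') (hfs : tsupport f ⊆ Ioo l r) :
    ∫ t in l..r, deriv (fun s => lagrangian m Ia (metricForm p) (chartConnForm σ p)
      (chartPos p (c t) + s • (f t • v))
      (deriv (fun τ => chartPos p (c τ)) t + s • (deriv f t • v))
      (pointerRate σ p univ c t + s * (κ * deriv f t))) 0 = 0 := by
  obtain ⟨hc, hcrit⟩ := hcrit
  have hIab : Ioo a' b' ⊆ Icc a b := fun t ht => ⟨haa.trans ht.1.le, ht.2.le.trans hbb⟩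
  have hlrI : Icc l r ⊆ Ioo a' b' := fun t ht => ⟨hl.trans_le ht.1, ht.2.trans_lt hr⟩
  have hT := uniqueDiffOn_Icc hab
  have h := isFramedMetric p hσ
  obtain ⟨hq, -, -, -⟩ := contDiffOn_pointer hσ hIab hc hI
  obtain ⟨ε, hε, hmem⟩ := exists_forall_add_smul_mem (isOpen_extChartAt_target p)
    (hq.continuousOn.mono hlrI) (fun t ht => chartPos_mem (hI t ht)) hlrI hf.continuous
    (hfs.trans Ioo_subset_Icc_self) v
  have hC := isVariation_variedCurve (κ := κ) hσ haa hbb hc hI hf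
    (hfs.trans (Ioo_subset_Icc_self.trans hlrI)) hε hmem
  set C := variedCurve σ p c (Ioo a' b') f v κ with hCdef
  set F : ℝ → ℝ → ℝ := fun s t => lagrangian m Ia (metricForm p) (chartConnForm σ p)
      (chartPos p (c t) + s • (f t • v))
      (deriv (fun τ => chartPos p (c τ)) t + s • (deriv f t • v))
      (pointerRate σ p univ c t + s * (κ * deriv f t)) with hF
  have hFC : ContDiffOn ℝ 1 (fun z : ℝ × ℝ => F z.1 z.2) (Ioo (-ε) ε ×ˢ Ioo a' b') := by
    have hsnd : MapsTo (Prod.snd : ℝ × ℝ → ℝ) (Ioo (-ε) ε ×ˢ Ioo a' b') (Ioo a' b') :=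
      fun z hz => hz.2
    have hfst : ContDiffOn ℝ ∞ (Prod.fst : ℝ × ℝ → ℝ) (Ioo (-ε) ε ×ˢ Ioo a' b') :=
      contDiff_fst.contDiffOn
    have hq2 := hq.comp contDiff_snd.contDiffOn hsnd
    have hq2' := (hq.deriv_of_isOpen (m := ∞) isOpen_Ioo (by simp)).comp
      contDiff_snd.contDiffOn hsnd
    have hr2 := (contDiffOn_pointerRate_univ hσ hIab hc hI).comp contDiff_snd.contDiffOn hsnd
    have hf2 : ContDiffOn ℝ ∞ (fun z : ℝ × ℝ => f z.2) (Ioo (-ε) ε ×ˢ Ioo a' b') :=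
      (hf.comp contDiff_snd).contDiffOn
    have hdf : ContDiff ℝ ∞ (deriv f) := hf.deriv'
    have hf2' : ContDiffOn ℝ ∞ (fun z : ℝ × ℝ => deriv f z.2) (Ioo (-ε) ε ×ˢ Ioo a' b') :=
      (hdf.comp contDiff_snd).contDiffOn
    have hpos : ContDiffOn ℝ ∞ (fun z : ℝ × ℝ => chartPos p (c z.2) + z.1 • (f z.2 • v))
        (Ioo (-ε) ε ×ˢ Ioo a' b') := hq2.add (hfst.smul (hf2.smul contDiffOn_const))
    have hmaps : MapsTo (fun z : ℝ × ℝ => chartPos p (c z.2) + z.1 • (f z.2 • v))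
        (Ioo (-ε) ε ×ˢ Ioo a' b') (extChartAt (𝓡 2) p).target :=
      fun z hz => hmem z.1 hz.1 z.2 hz.2
    have hvel := hq2'.add (hfst.smul (hf2'.smul (contDiffOn_const (c := v))))
    have hrate := hr2.add (hfst.mul ((contDiffOn_const (c := κ)).mul hf2'))
    have hg := (contDiffOn_metricForm p).comp hpos hmaps
    have hA := (contDiffOn_connForm h).comp hpos hmaps
    have hL := ((contDiffOn_const (c := 1 / 2 * m)).mul ((hg.clm_apply hvel).clm_apply hvel)).add
      ((contDiffOn_const (c := 1 / 2 * Ia)).mul ((hrate.add (hA.clm_apply hvel)).pow 2))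
    exact hL.of_le (by norm_cast)
  have hder := hasDerivAt_integral_of_contDiffOn hε hFC hl hlr.le hr
  have hunit : ∀ s ∈ Ioo (-ε) ε, IsUnitCurve a b (C s) := fun s hs =>
    ⟨fun t ht => ContMDiffWithinAt.comp (g := fun z : ℝ × ℝ => C z.1 z.2) t
      (hC.smooth (s, t) ⟨hs, ht⟩)
      ((contDiff_const.prodMk contDiff_id).contMDiff _).contMDiffWithinAt fun τ hτ => ⟨hs, hτ⟩,
      hC.unit s hs⟩
  -- outside the support of `f` the energy does not depend on `s`
  have hout : ∀ s, ∀ t ∈ Icc a b, t ∉ tsupport f →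
      energy m Ia (Icc a b) (C s) t = energy m Ia (Icc a b) c t := fun s t ht hts => by
    refine energy_congr (hT t ht) ht (hc.1 t ht) (Filter.Eventually.filter_mono nhdsWithin_le_nhds ?_)
    filter_upwards [(isClosed_tsupport f).isOpen_compl.mem_nhds hts] with τ hτ
    exact variedCurve_of_eq_zero hσ (hI τ) (by rw [image_eq_zero_of_notMem_tsupport hτ, mul_zero])
  have hal : a ≤ l := haa.trans hl.le
  have hrb : r ≤ b := hr.le.trans hbb
  have hact : ∀ s ∈ Ioo (-ε) ε, action m Ia a b (C s) =
      (∫ t in a..l, energy m Ia (Icc a b) c t) + (∫ t in l..r, F s t)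
        + ∫ t in r..b, energy m Ia (Icc a b) c t := by
    intro s hs
    have hcont := continuousOn_energy (m := m) (Ia := Ia) hab (hunit s hs)
    have i1 : IntervalIntegrable (energy m Ia (Icc a b) (C s)) MeasureTheory.volume a l :=
      (hcont.mono (Icc_subset_Icc_right (hlr.le.trans hrb))).intervalIntegrable_of_Icc hal
    have i2 : IntervalIntegrable (energy m Ia (Icc a b) (C s)) MeasureTheory.volume l r :=
      (hcont.mono (Icc_subset_Icc hal hrb)).intervalIntegrable_of_Icc hlr.le
    have i3 : IntervalIntegrable (energy m Ia (Icc a b) (C s)) MeasureTheory.volume r b :=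
      (hcont.mono (Icc_subset_Icc_left (hal.trans hlr.le))).intervalIntegrable_of_Icc hrb
    rw [action, ← intervalIntegral.integral_add_adjacent_intervals (i1.trans i2) i3,
      ← intervalIntegral.integral_add_adjacent_intervals i1 i2]
    congr 1
    · congr 1
      · refine intervalIntegral.integral_congr fun t ht => ?_
        rw [uIcc_of_le hal] at ht
        exact hout s t ⟨ht.1, ht.2.trans (hlr.le.trans hrb)⟩ fun h' => ht.2.not_gt (hfs h').1
      · refine intervalIntegral.integral_congr fun t ht => ?_
        rw [uIcc_of_le hlr.le] at ht
        exact energy_variedCurve hσ hab haa hbb hc hI hf hmem hC hs (hlrI ht)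
    · refine intervalIntegral.integral_congr fun t ht => ?_
      rw [uIcc_of_le hrb] at ht
      exact hout s t ⟨(hal.trans hlr.le).trans ht.1, ht.2⟩ fun h' => ht.1.not_gt (hfs h').2
  have hact' : HasDerivAt (fun s => action m Ia a b (C s))
      (∫ t in l..r, deriv (fun s => F s t) 0) 0 := by
    refine ((hder.const_add (∫ t in a..l, energy m Ia (Icc a b) c t)).add_const
      (∫ t in r..b, energy m Ia (Icc a b) c t)).congr_of_eventuallyEq ?_
    filter_upwards [isOpen_Ioo.mem_nhds (⟨by linarith, hε⟩ : (0 : ℝ) ∈ Ioo (-ε) ε)] with s hs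
    exact hact s hs
  exact hact'.unique (hcrit ε C hC)

/-- The Euler–Lagrange equations of a critical motion, in a chart. -/
theorem IsCritical.euler_lagrange {m Ia a b a' b' : ℝ} (hσ : σ ^ 2 = 1) (hIa : Ia ≠ 0)
    (hab : a < b) (haa : a ≤ a') (hbb : b' ≤ b) (hcrit : IsCritical m Ia a b c)
    (hI : ∀ t ∈ Ioo a' b', (c t).proj ∈ (chartAt Plane p).source) :
    ∀ t ∈ Ioo a' b',
      deriv (fun τ => pointerRate σ p univ c τ
        + chartConnForm σ p (chartPos p (c τ)) (deriv (fun τ => chartPos p (c τ)) τ)) t = 0 ∧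
      ∀ v, m * metricForm p (chartPos p (c t)) (deriv (deriv fun τ => chartPos p (c τ)) t
          + connection p (chartPos p (c t)) (deriv (fun τ => chartPos p (c τ)) t)
            (deriv (fun τ => chartPos p (c τ)) t)) v =
        Ia * (pointerRate σ p univ c t
          + chartConnForm σ p (chartPos p (c t)) (deriv (fun τ => chartPos p (c τ)) t)) *
          extDeriv₂ (chartConnForm σ p) (chartPos p (c t)) v
            (deriv (fun τ => chartPos p (c τ)) t) := by
  have hIab : Ioo a' b' ⊆ Icc a b := fun t ht => ⟨haa.trans ht.1.le, ht.2.le.trans hbb⟩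
  obtain ⟨hq, -, -, -⟩ := contDiffOn_pointer hσ hIab hcrit.1 hI
  exact (isFramedMetric p hσ).euler_lagrange hIa hq (fun t ht => chartPos_mem (hI t ht))
    (contDiffOn_pointerRate_univ hσ hIab hcrit.1 hI)
    fun v κ f hf l r hl hlr hr hfs =>
      hcrit.integral_deriv_lagrangian hσ hab haa hbb hI v κ hf hl hlr hr hfs

end Variation

/-! ### Orientation, and the equations of motion at a point -/

section Oriented

open Set Filter Topology

variable {M : Type*} [TopologicalSpace M] [ChartedSpace Plane M] [IsManifold (𝓡 2) ∞ M]
  [RiemannianBundle (fun x : M => TangentSpace (𝓡 2) x)]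
  {p : M} {σ : ℝ}

theorem frameArea_coord_pos (hσ : σ ^ 2 = 1) {y : Plane} (hy : y ∈ (extChartAt (𝓡 2) p).target) :
    0 < σ * frameArea (metricForm p) (frameFst p) (frameSnd σ p) y (stdVec 0) (stdVec 1) := by
  have h0 := metricCoeff_zero_zero_pos hy
  have hd := det_metricCoeff_pos hy
  have h1 : σ * frameArea (metricForm p) (frameFst p) (frameSnd σ p) y (stdVec 0) (stdVec 1) =
      (√(metricCoeff p y 0 0))⁻¹ * metricCoeff p y 0 0 * ((√(metricCoeff p y).det)⁻¹ *
        (√(metricCoeff p y 0 0))⁻¹ * (metricCoeff p y).det) := by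
    rw [Matrix.det_fin_two]
    simp only [frameArea, frameFst, frameSnd, map_smul, map_sub, ← metricCoeff_eq, smul_eq_mul,
      metricCoeff_symm p y 1 0, Matrix.det_fin_two]
    linear_combination ((√(metricCoeff p y 0 0))⁻¹ * metricCoeff p y 0 0 *
      ((√(metricCoeff p y 0 0 * metricCoeff p y 1 1 - metricCoeff p y 0 1 * metricCoeff p y 0 1))⁻¹ *
        (√(metricCoeff p y 0 0))⁻¹ *
        (metricCoeff p y 0 0 * metricCoeff p y 1 1 - metricCoeff p y 0 1 * metricCoeff p y 0 1))) * hσ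
  rw [h1]
  have := Real.sqrt_pos.2 h0
  have := Real.sqrt_pos.2 hd
  positivity

variable
  [IsContMDiffRiemannianBundle (𝓡 2) ∞ Plane (fun x : M => TangentSpace (𝓡 2) x)]
  {o : ∀ x : M, Orientation ℝ (TangentSpace (𝓡 2) x) (Fin 2)}
  {c : ℝ → TangentBundle (𝓡 2) M} {x : M}

/-- The area form is determined by its value on the frame. -/
theorem areaForm_ofCoord_eq_mul (hσ : σ ^ 2 = 1) (hx : x ∈ (chartAt Plane p).source) (X Y : Plane) :
    (o x).areaForm (ofCoord p x X) (ofCoord p x Y) =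
      frameArea (metricForm p) (frameFst p) (frameSnd σ p) (extChartAt (𝓡 2) p x) X Y *
        (o x).areaForm (ofCoord p x (frameFst p (extChartAt (𝓡 2) p x)))
          (ofCoord p x (frameSnd σ p (extChartAt (𝓡 2) p x))) := by
  have hy : extChartAt (𝓡 2) p x ∈ (extChartAt (𝓡 2) p).target :=
    (extChartAt (𝓡 2) p).map_source (by rwa [extChartAt_source])
  have h := isFramedMetric p hσ
  set y := extChartAt (𝓡 2) p x
  have h1 := h.expand y hy X
  have h2 := h.expand y hy Y
  rw [frameArea]
  conv_lhs => rw [← h1, ← h2]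
  simp only [map_add, map_smul, LinearMap.add_apply, LinearMap.smul_apply, smul_eq_mul,
    (o x).areaForm_apply_self]
  rw [(o x).areaForm_swap (ofCoord p x (frameSnd σ p y)) (ofCoord p x (frameFst p y))]
  ring

theorem areaForm_frame_sq (hσ : σ ^ 2 = 1) (hx : x ∈ (chartAt Plane p).source) :
    (o x).areaForm (ofCoord p x (frameFst p (extChartAt (𝓡 2) p x)))
          (ofCoord p x (frameSnd σ p (extChartAt (𝓡 2) p x))) ^ 2 = 1 := by
  have hy : extChartAt (𝓡 2) p x ∈ (extChartAt (𝓡 2) p).target :=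
    (extChartAt (𝓡 2) p).map_source (by rwa [extChartAt_source])
  have h := isFramedMetric p hσ
  have h1 := (o x).inner_sq_add_areaForm_sq (ofCoord p x (frameFst p (extChartAt (𝓡 2) p x)))
    (ofCoord p x (frameSnd σ p (extChartAt (𝓡 2) p x)))
  rw [← metricForm_extChartAt hx, norm_ofCoord_sq hx, norm_ofCoord_sq hx, h.fst_snd _ hy,
    h.fst_fst _ hy, h.snd_snd _ hy] at h1
  linarith

theorem areaForm_coordVec_ne_zero (hx : x ∈ (chartAt Plane p).source) :
    (o x).areaForm (coordVec p x 0) (coordVec p x 1) ≠ 0 := by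
  have hy : extChartAt (𝓡 2) p x ∈ (extChartAt (𝓡 2) p).target :=
    (extChartAt (𝓡 2) p).map_source (by rwa [extChartAt_source])
  have h1 := areaForm_ofCoord_eq_mul (o := o) (one_pow 2) hx (stdVec 0) (stdVec 1)
  have h2 := areaForm_frame_sq (o := o) (one_pow 2) hx
  have h3 := frameArea_coord_pos (one_pow 2) hy
  rw [one_mul] at h3
  change (o x).areaForm (ofCoord p x (stdVec 0)) (ofCoord p x (stdVec 1)) ≠ 0
  rw [h1]
  refine mul_ne_zero h3.ne' fun h0 => ?_
  rw [h0] at h2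
  norm_num at h2

/-- If the sign of the frame fits the orientation, the area form is the area in the frame. -/
theorem areaForm_ofCoord (hσ : σ ^ 2 = 1) (hx : x ∈ (chartAt Plane p).source)
    (ho : 0 < σ * (o x).areaForm (coordVec p x 0) (coordVec p x 1)) (X Y : Plane) :
    (o x).areaForm (ofCoord p x X) (ofCoord p x Y) =
      frameArea (metricForm p) (frameFst p) (frameSnd σ p) (extChartAt (𝓡 2) p x) X Y := by
  have hy : extChartAt (𝓡 2) p x ∈ (extChartAt (𝓡 2) p).target :=
    (extChartAt (𝓡 2) p).map_source (by rwa [extChartAt_source])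
  have h1 := areaForm_ofCoord_eq_mul (o := o) hσ hx
  have h2 := areaForm_frame_sq (o := o) hσ hx
  have h3 := frameArea_coord_pos hσ hy
  have h4 : (o x).areaForm (coordVec p x 0) (coordVec p x 1) = _ := h1 (stdVec 0) (stdVec 1)
  rw [h4, ← mul_assoc] at ho
  have h5 := (pow_eq_one_iff_of_nonneg ((mul_pos_iff_of_pos_left h3).1 ho).le two_ne_zero).1 h2
  rw [h1, h5, mul_one]

/-- Near every time, the motion stays in a chart on which the orientation has a constant sign. -/
theorem exists_sign_eventually (ho : IsOrientationField o) {T : Set ℝ} {t₀ : ℝ}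
    (hc : ContMDiffWithinAt 𝓘(ℝ, ℝ) (𝓡 2).tangent ∞ c T t₀) :
    ∃ σ : ℝ, σ ^ 2 = 1 ∧ ∀ᶠ t in 𝓝[T] t₀, (c t).proj ∈ (chartAt Plane (c t₀).proj).source ∧
      0 < σ * (o (c t).proj).areaForm (coordVec (c t₀).proj (c t).proj 0)
        (coordVec (c t₀).proj (c t).proj 1) := by
  have hcont := (Bundle.contMDiffWithinAt_totalSpace.1 hc).1.continuousWithinAt
  have hmem : (c t₀).proj ∈ (chartAt Plane (c t₀).proj).source := mem_chart_source _ _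
  have hnhds := (chartAt Plane (c t₀).proj).open_source.mem_nhds hmem
  have hev : ∀ᶠ t in 𝓝[T] t₀, (c t).proj ∈ (chartAt Plane (c t₀).proj).source :=
    hcont.eventually_mem hnhds
  have harea := ContinuousAt.comp_continuousWithinAt (f := fun t => (c t).proj) (x := t₀)
    (g := fun x => (o x).areaForm (coordVec (c t₀).proj x 0) (coordVec (c t₀).proj x 1))
    ((ho (c t₀).proj).continuousAt hnhds) hcont
  have hne := areaForm_coordVec_ne_zero (o := o) hmem
  refine ⟨SignType.sign ((o (c t₀).proj).areaForm (coordVec (c t₀).proj (c t₀).proj 0)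
    (coordVec (c t₀).proj (c t₀).proj 1)), ?_, hev.and ?_⟩
  · rcases lt_or_gt_of_ne hne with h | h
    · simp [sign_neg h]
    · simp [sign_pos h]
  · refine (harea.const_mul _).eventually (lt_mem_nhds ?_)
    simp only [Function.comp]
    rw [sign_mul_self]
    exact abs_pos.2 hne

/-- The axial angular velocity in a chart. -/
def chartAxial (σ : ℝ) (p : M) (T : Set ℝ) (c : ℝ → TangentBundle (𝓡 2) M) (t : ℝ) : ℝ :=
  pointerRate σ p T c t + chartConnForm σ p (chartPos p (c t))
    (derivWithin (fun τ => chartPos p (c τ)) T t)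

theorem axialVelocity_eq {a b t : ℝ} (hσ : σ ^ 2 = 1) (hab : a < b) (hc : IsUnitCurve a b c)
    (ht : t ∈ Icc a b)
    (hp : (c t).proj ∈ (chartAt Plane p).source)
    (ho : 0 < σ * (o (c t).proj).areaForm (coordVec p (c t).proj 0) (coordVec p (c t).proj 1)) :
    axialVelocity o (Icc a b) c t = chartAxial σ p (Icc a b) c t := by
  have hT := uniqueDiffOn_Icc hab t ht
  have hy := chartPos_mem hp
  have h := isFramedMetric p hσ
  have hbase := (Bundle.contMDiffWithinAt_totalSpace.1 (hc.1 t ht)).1.continuousWithinAt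
  have hev : ∀ᶠ τ in 𝓝[Icc a b] t, τ ∈ Icc a b ∧ (c τ).proj ∈ (chartAt Plane p).source :=
    Filter.Eventually.and self_mem_nhdsWithin
      (hbase.eventually_mem ((chartAt Plane p).open_source.mem_nhds hp))
  have dq := contDiffWithinAt_chartPos (hc.1 t ht) hp
  have dX := contDiffWithinAt_chartVec ht (hc.1 t ht) hp
  have dg : ContDiffWithinAt ℝ ∞ (fun τ => metricForm p (chartPos p (c τ))) (Icc a b) t :=
    ContDiffAt.comp_contDiffWithinAt (g := metricForm p) (f := fun τ => chartPos p (c τ)) t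
      ((contDiffOn_metricForm p).contDiffAt (h.isOpen.mem_nhds hy)) dq
  have dα : DifferentiableWithinAt ℝ (fun τ => pointerFst p (c τ)) (Icc a b) t :=
    ((dg.clm_apply dX).clm_apply (ContDiffAt.comp_contDiffWithinAt (g := frameFst p)
      (f := fun τ => chartPos p (c τ)) t (h.contDiffAt_fst hy) dq)).differentiableWithinAt (by simp)
  have dβ : DifferentiableWithinAt ℝ (fun τ => pointerSnd σ p (c τ)) (Icc a b) t :=
    ((dg.clm_apply dX).clm_apply (ContDiffAt.comp_contDiffWithinAt (g := frameSnd σ p)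
      (f := fun τ => chartPos p (c τ)) t (h.contDiffAt_snd hy) dq)).differentiableWithinAt (by simp)
  have hD := derivWithin_add_connection hσ hT ht hy
    (dq.differentiableWithinAt (by simp)).hasDerivWithinAt dα.hasDerivWithinAt dβ.hasDerivWithinAt
    (hev.mono fun τ hτ => pointerFst_sq_add_pointerSnd_sq hσ hτ.2 (hc.2 τ hτ.1))
    (hev.mono fun τ hτ => chartVec_eq hσ hτ.2)
  have hu := pointerFst_sq_add_pointerSnd_sq hσ hp (hc.2 t ht)
  have hpt : pointer c t = ofCoord p (c t).proj (chartVec p (c t)) :=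
    (ofCoord_toCoord hp _).symm
  rw [axialVelocity, covDeriv_pointer_eq hT ht (hc.1 t ht) hp, hD, hpt]
  refine (real_inner_comm _ _).trans ((Orientation.inner_rightAngleRotation_left _ _ _).trans
    ((areaForm_ofCoord hσ hp ho _ _).trans ?_))
  rw [chartVec_eq hσ hp]
  change frameArea (metricForm p) (frameFst p) (frameSnd σ p) (chartPos p (c t)) _ _ = _
  simp only [frameArea, map_smul, map_sub, map_add, smul_apply, sub_apply, add_apply, smul_eq_mul,
    h.fst_fst _ hy, h.snd_snd _ hy, h.fst_snd _ hy,
    h.symm _ hy (frameSnd σ p (chartPos p (c t))) (frameFst p (chartPos p (c t)))]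
  rw [chartAxial, pointerRate]
  linear_combination (pointerFst p (c t) * derivWithin (fun τ => pointerSnd σ p (c τ)) (Icc a b) t
    - pointerSnd σ p (c t) * derivWithin (fun τ => pointerFst p (c τ)) (Icc a b) t
    + chartConnForm σ p (chartPos p (c t))
      (derivWithin (fun τ => chartPos p (c τ)) (Icc a b) t)) * hu

/-- The equations of motion at the time `t₀`, which may be an endpoint: they hold in the chart
around `γ t₀` at interior times near `t₀`, and extend to `t₀` by continuity. -/
theorem IsCritical.equations_at {m Ia a b t₀ : ℝ} (ho : IsOrientationField o) (hIa : Ia ≠ 0)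
    (hab : a < b) (hcrit : IsCritical m Ia a b c) (ht₀ : t₀ ∈ Icc a b) :
    HasDerivWithinAt (axialVelocity o (Icc a b) c) 0 (Icc a b) t₀ ∧
      m • covDeriv (Icc a b) (baseCurve c) (velocity (Icc a b) (baseCurve c)) t₀ =
        (Ia * axialVelocity o (Icc a b) c t₀ * gaussianCurvature (baseCurve c t₀)) •
          (o (baseCurve c t₀)).rightAngleRotation (velocity (Icc a b) (baseCurve c) t₀) := by
  have hc := hcrit.1
  have hT := uniqueDiffOn_Icc hab
  obtain ⟨σ, hσ, hev⟩ := exists_sign_eventually ho (hc.1 t₀ ht₀)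
  obtain ⟨V₀, hV₀, htV₀, hV₀s⟩ := mem_nhdsWithin.1 hev
  obtain ⟨δ, hδ, hball⟩ := Metric.isOpen_iff.1 hV₀ t₀ htV₀
  rw [Real.ball_eq_Ioo] at hball
  set p := (c t₀).proj with hp
  set T := Icc a b with hTdef
  set V := Ioo (t₀ - δ) (t₀ + δ) with hVdef
  have hV : IsOpen V := isOpen_Ioo
  have htV : t₀ ∈ V := ⟨by linarith, by linarith⟩
  have hS : ∀ t ∈ T ∩ V, (c t).proj ∈ (chartAt Plane p).source ∧
      0 < σ * (o (c t).proj).areaForm (coordVec p (c t).proj 0) (coordVec p (c t).proj 1) :=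
    fun t ht => hV₀s ⟨hball ht.2, ht.1⟩
  have hSt : t₀ ∈ T ∩ V := ⟨ht₀, htV⟩
  have hSnhds : T ∩ V ∈ 𝓝[T] t₀ := inter_mem_nhdsWithin T (hV.mem_nhds htV)
  -- the interior times near `t₀`
  set a' := max a (t₀ - δ) with ha'
  set b' := min b (t₀ + δ) with hb'
  have hab' : a' < b' := max_lt (lt_min hab (by linarith [ht₀.1]))
    (lt_min (by linarith [ht₀.2]) (by linarith))
  have hIS : Ioo a' b' ⊆ T ∩ V := fun t ht =>
    ⟨⟨(le_max_left _ _).trans ht.1.le, ht.2.le.trans (min_le_left _ _)⟩,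
      (le_max_right _ _).trans_lt ht.1, ht.2.trans_le (min_le_right _ _)⟩
  have hScl : T ∩ V ⊆ closure (Ioo a' b') := by
    rw [closure_Ioo hab'.ne]
    exact fun t ht => ⟨max_le ht.1.1 ht.2.1.le, le_min ht.1.2 ht.2.2.le⟩
  have hTn : ∀ t ∈ Ioo a' b', T ∈ 𝓝 t := fun t ht =>
    mem_of_superset (isOpen_Ioo.mem_nhds ht) fun s hs => (hIS hs).1
  have hEL := hcrit.euler_lagrange hσ hIa hab (le_max_left _ _) (min_le_left _ _)
    fun t ht => (hS t (hIS ht)).1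
  -- smoothness of the coordinate expressions, up to the endpoints
  obtain ⟨hq, -, hα, hβ⟩ := contDiffOn_pointer hσ inter_subset_left hc fun t ht => (hS t ht).1
  have hmaps : MapsTo (fun τ => chartPos p (c τ)) (T ∩ V) (extChartAt (𝓡 2) p).target :=
    fun t ht => chartPos_mem (hS t ht).1
  set q := fun τ => chartPos p (c τ) with hqdef
  have hq' := contDiffOn_derivWithin_inter hT hV hq
  have hq'' := contDiffOn_derivWithin_inter hT hV hq'
  have hα' := contDiffOn_derivWithin_inter hT hV hα
  have hβ' := contDiffOn_derivWithin_inter hT hV hβ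
  have hg := (contDiffOn_metricForm p).comp hq hmaps
  have hΓ := (contDiffOn_connection p).comp hq hmaps
  have hA0 := contDiffOn_connForm (isFramedMetric p hσ)
  have hA := hA0.comp hq hmaps
  have hdA := (hA0.fderiv_of_isOpen (m := ∞) (isOpen_extChartAt_target p) (by simp)).comp hq hmaps
  have hw : ContDiffOn ℝ ∞ (chartAxial σ p T c) (T ∩ V) :=
    ((hα.mul hβ').sub (hβ.mul hα')).add (hA.clm_apply hq')
  have hw' := contDiffOn_derivWithin_inter hT hV hw
  -- interior times: derivatives within `T` are derivatives
  have dq : ∀ t ∈ Ioo a' b', derivWithin q T t = deriv q t := fun t ht =>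
    derivWithin_of_mem_nhds (hTn t ht)
  have dq2 : ∀ t ∈ Ioo a' b', derivWithin (derivWithin q T) T t = deriv (deriv q) t :=
    fun t ht => by
      rw [derivWithin_of_mem_nhds (hTn t ht)]
      refine Filter.EventuallyEq.deriv_eq ?_
      filter_upwards [isOpen_Ioo.mem_nhds ht] with s hs using dq s hs
  have dw : ∀ t ∈ Ioo a' b', chartAxial σ p T c t = pointerRate σ p univ c t
      + chartConnForm σ p (chartPos p (c t)) (deriv q t) := fun t ht => by
    rw [chartAxial, dq t ht, pointerRate, pointerRate, derivWithin_univ, derivWithin_univ,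
      derivWithin_of_mem_nhds (hTn t ht), derivWithin_of_mem_nhds (hTn t ht)]
  have hw0 : derivWithin (chartAxial σ p T c) T t₀ = 0 := by
    refine Set.EqOn.of_subset_closure (g := fun _ => (0 : ℝ)) (fun t ht => ?_) hw'.continuousOn
      continuousOn_const hIS hScl hSt
    rw [derivWithin_of_mem_nhds (hTn t ht)]
    refine Eq.trans (Filter.EventuallyEq.deriv_eq ?_) (hEL t ht).1
    filter_upwards [isOpen_Ioo.mem_nhds ht] with s hs using dw s hs
  have hax : ∀ t ∈ T ∩ V, axialVelocity o T c t = chartAxial σ p T c t := fun t ht =>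
    axialVelocity_eq hσ hab hc ht.1 (hS t ht).1 (hS t ht).2
  refine ⟨?_, ?_⟩
  · have hd : DifferentiableWithinAt ℝ (chartAxial σ p T c) T t₀ :=
      ((hw t₀ hSt).differentiableWithinAt (by simp)).mono_of_mem_nhdsWithin hSnhds
    have := hd.hasDerivWithinAt
    rw [hw0] at this
    exact this.congr_of_eventuallyEq (mem_of_superset hSnhds hax) (hax t₀ hSt)
  · have hsrc := (hS t₀ hSt).1
    have hγ : ∀ t ∈ T, MDifferentiableWithinAt 𝓘(ℝ, ℝ) (𝓡 2) (baseCurve c) T t := fun t ht =>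
      mdifferentiableWithinAt_baseCurve (hc.1 t ht)
    have hvel : (fun τ => toCoord p (baseCurve c τ) (velocity T (baseCurve c) τ)) =ᶠ[𝓝[T] t₀]
        derivWithin q T := by
      filter_upwards [hSnhds] with τ hτ
      exact toCoord_velocity (hT τ hτ.1) (hγ τ hτ.1) (hS τ hτ).1
    have hdv : DifferentiableWithinAt ℝ (derivWithin q T) T t₀ :=
      ((hq' t₀ hSt).differentiableWithinAt (by simp)).mono_of_mem_nhdsWithin hSnhds
    have hvel0 : toCoord p (baseCurve c t₀) (velocity T (baseCurve c) t₀) = derivWithin q T t₀ :=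
      hvel.self_of_nhdsWithin ht₀
    have hcov := covDeriv_eq (p := p) (hT t₀ ht₀) (hγ t₀ ht₀) hsrc
      (hdv.congr_of_eventuallyEq hvel hvel0)
    rw [hvel.derivWithin_eq_of_mem ht₀, hvel0] at hcov
    have hv0 : velocity T (baseCurve c) t₀ = ofCoord p (c t₀).proj (derivWithin q T t₀) :=
      velocity_eq (hT t₀ ht₀) (hc.1 t₀ ht₀) hsrc
    -- the Euler–Lagrange equation at `t₀`
    have hEL0 : ∀ v, m * metricForm p (q t₀) (derivWithin (derivWithin q T) T t₀
          + connection p (q t₀) (derivWithin q T t₀) (derivWithin q T t₀)) v =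
        Ia * chartAxial σ p T c t₀ *
          extDeriv₂ (chartConnForm σ p) (q t₀) v (derivWithin q T t₀) := by
      intro v
      refine Set.EqOn.of_subset_closure
        (f := fun t => m * metricForm p (q t) (derivWithin (derivWithin q T) T t
          + connection p (q t) (derivWithin q T t) (derivWithin q T t)) v)
        (g := fun t => Ia * chartAxial σ p T c t *
          extDeriv₂ (chartConnForm σ p) (q t) v (derivWithin q T t))
        (fun t ht => ?_) ?_ ?_ hIS hScl hSt
      · simp only [dq2 t ht, dq t ht, dw t ht]
        exact (hEL t ht).2 v
      · exact (contDiffOn_const.mul ((hg.clm_apply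
          (hq''.add ((hΓ.clm_apply hq').clm_apply hq'))).clm_apply contDiffOn_const)).continuousOn
      · exact ((contDiffOn_const.mul hw).mul
          (((hdA.clm_apply contDiffOn_const).clm_apply hq').sub
            ((hdA.clm_apply hq').clm_apply contDiffOn_const))).continuousOn
    refine ext_inner_right ℝ fun Z => ?_
    have hZ : Z = ofCoord p (c t₀).proj (toCoord p (c t₀).proj Z) := (ofCoord_toCoord hsrc Z).symm
    have h1 := hEL0 (toCoord p (c t₀).proj Z)
    have hK := extDeriv₂_eq_neg_gaussianCurvature_mul p hσ (toCoord p (c t₀).proj Z)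
      (derivWithin q T t₀)
    have h2 := metricForm_extChartAt (p := p) hsrc
      (derivWithin (derivWithin q T) T t₀
          + connection p (q t₀) (derivWithin q T t₀) (derivWithin q T t₀))
      (toCoord p (c t₀).proj Z)
    have h3 := areaForm_ofCoord (o := o) hσ hsrc (hS t₀ hSt).2 (derivWithin q T t₀)
      (toCoord p (c t₀).proj Z)
    rw [← hZ] at h2 h3
    have h4 : ⟪covDeriv T (baseCurve c) (velocity T (baseCurve c)) t₀, Z⟫ =
        metricForm p (q t₀) (derivWithin (derivWithin q T) T t₀
          + connection p (q t₀) (derivWithin q T t₀) (derivWithin q T t₀))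
          (toCoord p (c t₀).proj Z) := by
      rw [hcov]; exact h2.symm
    have h5 : (o (baseCurve c t₀)).areaForm (velocity T (baseCurve c) t₀) Z =
        frameArea (metricForm p) (frameFst p) (frameSnd σ p) (q t₀) (derivWithin q T t₀)
          (toCoord p (c t₀).proj Z) := by
      rw [hv0]; exact h3
    have h6 : frameArea (metricForm p) (frameFst p) (frameSnd σ p) (q t₀)
        (toCoord p (c t₀).proj Z) (derivWithin q T t₀) =
        -frameArea (metricForm p) (frameFst p) (frameSnd σ p) (q t₀) (derivWithin q T t₀)
          (toCoord p (c t₀).proj Z) := by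
      simp only [frameArea]; ring
    have hK' : extDeriv₂ (chartConnForm σ p) (q t₀) (toCoord p (c t₀).proj Z)
        (derivWithin q T t₀) = gaussianCurvature p *
        frameArea (metricForm p) (frameFst p) (frameSnd σ p) (q t₀) (derivWithin q T t₀)
          (toCoord p (c t₀).proj Z) := by
      refine hK.trans ?_
      change -(_ * frameArea _ _ _ (q t₀) _ _) = _
      rw [h6]; ring
    rw [real_inner_smul_left, real_inner_smul_left, Orientation.inner_rightAngleRotation_left,
      h4, h5, h1, hK', hax t₀ hSt]
    change _ = Ia * _ * gaussianCurvature p * _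
    ring

end Oriented

end SpinningDisk

end

theorem theorem2 {M : Type*} [TopologicalSpace M] [ChartedSpace SpinningDisk.Plane M]
    [IsManifold (𝓡 2) ∞ M]
    [RiemannianBundle (fun x : M => TangentSpace (𝓡 2) x)]
    [IsContMDiffRiemannianBundle (𝓡 2) ∞ SpinningDisk.Plane
      (fun x : M => TangentSpace (𝓡 2) x)]
    (o : ∀ x : M, Orientation ℝ (TangentSpace (𝓡 2) x) (Fin 2))
    (ho : SpinningDisk.IsOrientationField o)
    (m Ia a b : ℝ) (hm : 0 < m) (hIa : 0 < Ia) (hab : a < b)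
    (c : ℝ → TangentBundle (𝓡 2) M) (hc : SpinningDisk.IsCritical m Ia a b c) :
    ∃ L : ℝ, ∀ t ∈ Set.Icc a b,
      Ia * SpinningDisk.axialVelocity o (Set.Icc a b) c t = L ∧
      m • SpinningDisk.covDeriv (Set.Icc a b) (SpinningDisk.baseCurve c)
          (SpinningDisk.velocity (Set.Icc a b) (SpinningDisk.baseCurve c)) t =
        (L * SpinningDisk.gaussianCurvature (SpinningDisk.baseCurve c t)) •
          (o (SpinningDisk.baseCurve c t)).rightAngleRotation
            (SpinningDisk.velocity (Set.Icc a b) (SpinningDisk.baseCurve c) t) := by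
  have h := fun t (ht : t ∈ Set.Icc a b) => hc.equations_at ho hIa.ne' hab ht
  have hconst : ∀ t ∈ Set.Icc a b, SpinningDisk.axialVelocity o (Set.Icc a b) c t =
      SpinningDisk.axialVelocity o (Set.Icc a b) c a :=
    constant_of_derivWithin_zero (fun t ht => (h t ht).1.differentiableWithinAt)
      fun t ht => (h t ⟨ht.1, ht.2.le⟩).1.derivWithin
        (uniqueDiffOn_Icc hab t ⟨ht.1, ht.2.le⟩)
  refine ⟨Ia * SpinningDisk.axialVelocity o (Set.Icc a b) c a, fun t ht => ⟨?_, ?_⟩⟩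
  · rw [hconst t ht]
  · rw [(h t ht).2, hconst t ht]
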